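/- Let $h>0$, $M_1,M_2\ge 1$, and let $G$ be the continuous-time generalized plant $$\dot x=Ax+B_1w+B_2u,\quad z=C_1x+D_{11}w+D_{12}u,\quad y=C_2x,\qquad x(0)=0,$$ with real matrices of arbitrary finite sizes, so that $G=\begin{bmatrix}G_{11}&G_{12}\\G_{21}&G_{22}\end{bmatrix}$, where $G_{21},G_{22}$ are strictly proper, $G_{11},G_{12}$ are proper, and $(G_{ij}v)(t)=\int_0^tC_ie^{(t-\tau)A}B_jv(\tau)\,d\tau+D_{ij}v(t)$ (with $D_{21}=D_{22}=0$). For $\delta>0$ let $S_\delta$, $(S_\delta u)[k]=u(k\delta)$, be the ideal sampler, and $H_\delta$, $(H_\delta v)(t)=v[k]$ for $t\in[k\delta,(k+1)\delta)$, the zero-order hold. Let $\mathbf L_N$ be the discrete-time lifting that maps a sequence $v$ to the sequence whose $k$-th term stacks $v[kN],\dots,v[kN+N-1]$. Put $\mathcal F_l(P,Q)=P_{11}+P_{12}Q(I-P_{22}Q)^{-1}P_{21}$, and let $\|\cdot\|$ denote the operator norm induced by the $L^2[0,\infty)$ norms for continuous-time systems and by the $\ell^2$ norms for discrete-time systems (Euclidean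 norms on the values). Let $\mathcal K$ be a linear discrete-time controller that is $(M_1,M_2)$-periodic, i.e. $\mathsf z^{M_2}\mathcal K\mathsf z^{-M_1}=\mathcal K$ with $\mathsf z$ the unit advance and $\mathsf z^{-1}$ the unit delay, and suppose that $K_d:=\mathbf L_{M_2}\mathcal K\mathbf L_{M_1}^{-1}$ is given by a finite-dimensional state-space realization $\xi[k+1]=A_K\xi[k]+B_Ky_d[k]$, $u_d[k]=C_K\xi[k]+D_Ky_d[k]$, $\xi[0]=0$. Suppose that the feedback loop of $G$ and $H_{h/M_2}\mathcal KS_{h/M_1}$ is well-posed (the matrix $I-D_hD_K$ is invertible, $D_h$ being the feedthrough matrix of $\mathbf L_{M_1}S_{h/M_1}G_{22}H_{h/M_2}\mathbf L_{M_2}^{-1}$) and internally stable: with $w=0$, the matrix $A_{\rm cl}$ that maps the plant and controller states $(x(kh),\xi[k])$ to $(x((k+1)h),\xi[k+1])$ satisfies $A_{\rm cl}^k\to0$ as $k\to\infty$. Consider the multirate sampled-data system $\mathcal T:=\mathcal F_l(G,H_{h/M_2}\mathcal KS_{h/M_1})$ and, for $N\ge1$, its fast-sampling/fast-hold approximation $T_{dN}:=\mathcal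 F_l(\widetilde G_{dN},K_d)$, where $$\widetilde G_{dN}:=\begin{bmatrix}\mathbf L_NS_{h/N}&0\\0&\mathbf L_{M_1}S_{h/M_1}\end{bmatrix}\begin{bmatrix}G_{11}&G_{12}\\G_{21}&G_{22}\end{bmatrix}\begin{bmatrix}H_{h/N}\mathbf L_N^{-1}&0\\0&H_{h/M_2}\mathbf L_{M_2}^{-1}\end{bmatrix}.$$ Then both linear fractional transformations are well defined (the maps $I-P_{22}Q$ in them are bijective), $\mathcal T$ is a bounded operator on $L^2[0,\infty)$, every $T_{dN}$ with $N\ge1$ is a finite-dimensional linear time-invariant discrete-time system, having a state-space realization with state matrix $A_{\rm cl}$, and $$\lim_{N\to\infty}\|T_{dN}\|=\|\mathcal T\|.$$ -/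

import Mathlib

open MeasureTheory Filter Topology
open scoped ENNReal

namespace SampledData

noncomputable section

/-! Continuous-time signals are functions of `t : ℝ` of which only the values at `t ≥ 0` matter;
discrete-time signals are functions of `k : ℕ`. Values lie in Euclidean spaces. -/

/-! ### Norms and linear fractional transformations -/

/-- Lebesgue measure on the time axis `[0, ∞)`. -/
def timeMeasure : Measure ℝ := volume.restrict (Set.Ici 0)

/-- The `L²`-induced norm `sup_{w ∈ L², w ≠ 0} ‖T w‖ / ‖w‖`, as an extended nonnegative number.
With `μ = ν = Measure.count` on `ℕ` it is the `ℓ²`-induced norm. -/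
def inducedNorm {α β E F : Type*} [MeasurableSpace α] [MeasurableSpace β]
    [NormedAddCommGroup E] [NormedAddCommGroup F] (μ : Measure α) (ν : Measure β)
    (T : (α → E) → (β → F)) : ℝ≥0∞ :=
  ⨆ (w : α → E) (_ : MemLp w 2 μ) (_ : eLpNorm w 2 μ ≠ 0), eLpNorm (T w) 2 ν / eLpNorm w 2 μ

/-- The map `I - P K`. -/
def loopMap {Y U : Type*} [AddCommGroup Y] (P : U → Y) (K : Y → U) : Y → Y :=
  fun y => y - P (K y)

/-- `F_l(P, K) = P₁₁ + P₁₂ K (I - P₂₂ K)⁻¹ P₂₁`. It is meaningful when `I - P₂₂ K` is bijective. -/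
def lft {W Z Y U : Type*} [AddCommGroup Z] [AddCommGroup Y]
    (P₁₁ : W → Z) (P₁₂ : U → Z) (P₂₁ : W → Y) (P₂₂ : U → Y) (K : Y → U) : W → Z :=
  fun w => P₁₁ w + P₁₂ (K (Function.invFun (loopMap P₂₂ K) (P₂₁ w)))

/-! ### Linear systems -/

/-- The continuous-time system `ẋ = A x + B w, z = C x + D w, x(0) = 0` as an operator on signals,
`z(t) = ∫₀ᵗ C e^{(t-τ)A} B w(τ) dτ + D w(t)`. -/
def contSys {n m p : ℕ} (A : Matrix (Fin n) (Fin n) ℝ) (B : Matrix (Fin n) (Fin m) ℝ)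
    (C : Matrix (Fin p) (Fin n) ℝ) (D : Matrix (Fin p) (Fin m) ℝ)
    (w : ℝ → EuclideanSpace ℝ (Fin m)) : ℝ → EuclideanSpace ℝ (Fin p) :=
  fun t => (∫ τ in (0 : ℝ)..t,
      Matrix.toEuclideanLin (C * NormedSpace.exp ((t - τ) • A) * B) (w τ))
    + Matrix.toEuclideanLin D (w t)

/-- The state of the discrete-time system `x[k+1] = A x[k] + B v[k], x[0] = 0`. -/
def discState {σ ι : Type*} [Fintype σ] [DecidableEq σ] [Fintype ι] [DecidableEq ι]
    (A : Matrix σ σ ℝ) (B : Matrix σ ι ℝ) (v : ℕ → EuclideanSpace ℝ ι) :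
    ℕ → EuclideanSpace ℝ σ
  | 0 => 0
  | k + 1 => Matrix.toEuclideanLin A (discState A B v k) + Matrix.toEuclideanLin B (v k)

/-- The finite-dimensional LTI discrete-time system
`x[k+1] = A x[k] + B v[k], z[k] = C x[k] + D v[k], x[0] = 0`, with transfer function
`C (zI - A)⁻¹ B + D`, as an operator on sequences. -/
def discSys {σ ι κ : Type*} [Fintype σ] [DecidableEq σ] [Fintype ι] [DecidableEq ι]
    (A : Matrix σ σ ℝ) (B : Matrix σ ι ℝ) (C : Matrix κ σ ℝ) (D : Matrix κ ι ℝ)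
    (v : ℕ → EuclideanSpace ℝ ι) : ℕ → EuclideanSpace ℝ κ :=
  fun k => Matrix.toEuclideanLin C (discState A B v k) + Matrix.toEuclideanLin D (v k)

/-! ### Sampler, hold, discrete-time lifting, periodicity -/

/-- The ideal sampler with period `h`. -/
def sampler {E : Type*} (h : ℝ) (u : ℝ → E) : ℕ → E := fun k => u (k * h)

/-- The zero-order hold with period `h`: the value is `v[k]` on `[kh, (k+1)h)`. -/
def hold {E : Type*} (h : ℝ) (v : ℕ → E) : ℝ → E := fun t => v ⌊t / h⌋₊

/-- Discrete-time lifting by the factor `N`: the `k`-th value stacks `v[kN], …, v[kN+N-1]`. -/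
def lift {m : ℕ} (N : ℕ) (v : ℕ → EuclideanSpace ℝ (Fin m)) :
    ℕ → EuclideanSpace ℝ (Fin N × Fin m) :=
  fun k => WithLp.toLp 2 (fun c => v (k * N + c.1) c.2)

/-- The inverse of the lifting (for `N > 0`). -/
def unlift {m : ℕ} (N : ℕ) (v : ℕ → EuclideanSpace ℝ (Fin N × Fin m)) :
    ℕ → EuclideanSpace ℝ (Fin m) :=
  fun i => WithLp.toLp 2 (fun c =>
    if hN : 0 < N then v (i / N) (⟨i % N, Nat.mod_lt i hN⟩, c) else 0)

/-- `z^M`, advance by `M` steps. -/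
def advance {E : Type*} (M : ℕ) (v : ℕ → E) : ℕ → E := fun k => v (k + M)

/-- `z^{-M}`, delay by `M` steps. -/
def delay {E : Type*} [Zero E] (M : ℕ) (v : ℕ → E) : ℕ → E :=
  fun k => if k < M then 0 else v (k - M)

/-- `K` is `(M₁, M₂)`-periodic: `z^{M₂} K z^{-M₁} = K`. -/
def IsPeriodic {E F : Type*} [Zero E] (M₁ M₂ : ℕ) (K : (ℕ → E) → (ℕ → F)) : Prop :=
  ∀ v, advance M₂ (K (delay M₁ v)) = K v

/-! ### The generalized plant -/

/-- State-space data of the generalized plant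
`ẋ = A x + B₁ w + B₂ u, z = C₁ x + D₁₁ w + D₁₂ u, y = C₂ x`. -/
structure Plant (n nw nu nz ny : ℕ) where
  A : Matrix (Fin n) (Fin n) ℝ
  B₁ : Matrix (Fin n) (Fin nw) ℝ
  B₂ : Matrix (Fin n) (Fin nu) ℝ
  C₁ : Matrix (Fin nz) (Fin n) ℝ
  C₂ : Matrix (Fin ny) (Fin n) ℝ
  D₁₁ : Matrix (Fin nz) (Fin nw) ℝ
  D₁₂ : Matrix (Fin nz) (Fin nu) ℝ

/-- State-space data `{A, B, C, D}` of a discrete-time controller with inputs indexed by `ι` and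
outputs indexed by `κ`. -/
structure Controller (σ ι κ : Type*) where
  A : Matrix σ σ ℝ
  B : Matrix σ ι ℝ
  C : Matrix κ σ ℝ
  D : Matrix κ ι ℝ

variable {n nw nu nz ny nk : ℕ}

namespace Plant

variable (G : Plant n nw nu nz ny)

/-- The operator `w ↦ z`. -/
def G₁₁ : (ℝ → EuclideanSpace ℝ (Fin nw)) → (ℝ → EuclideanSpace ℝ (Fin nz)) :=
  contSys G.A G.B₁ G.C₁ G.D₁₁

/-- The operator `u ↦ z`. -/
def G₁₂ : (ℝ → EuclideanSpace ℝ (Fin nu)) → (ℝ → EuclideanSpace ℝ (Fin nz)) :=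
  contSys G.A G.B₂ G.C₁ G.D₁₂

/-- The operator `w ↦ y`. -/
def G₂₁ : (ℝ → EuclideanSpace ℝ (Fin nw)) → (ℝ → EuclideanSpace ℝ (Fin ny)) :=
  contSys G.A G.B₁ G.C₂ 0

/-- The operator `u ↦ y`. -/
def G₂₂ : (ℝ → EuclideanSpace ℝ (Fin nu)) → (ℝ → EuclideanSpace ℝ (Fin ny)) :=
  contSys G.A G.B₂ G.C₂ 0

/-! #### The plant seen by the lifted controller

`L_{M₁} S_{h/M₁} G₂₂ H_{h/M₂} L_{M₂}⁻¹` has the realization `x[k+1] = Ah x[k] + Bh u_d[k]`,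
`y_d[k] = Ch x[k] + Dh u_d[k]`, where `x[k]` is the plant state at time `kh`. -/

/-- `e^{hA}`. -/
def Ah (h : ℝ) : Matrix (Fin n) (Fin n) ℝ := NormedSpace.exp (h • G.A)

/-- The block column `j` is `∫_{jh/M₂}^{(j+1)h/M₂} e^{(h-τ)A} B₂ dτ`. -/
def Bh (h : ℝ) (M₂ : ℕ) : Matrix (Fin n) (Fin M₂ × Fin nu) ℝ :=
  Matrix.of fun a c => ∫ τ in ((c.1 : ℝ) * (h / M₂))..(((c.1 : ℝ) + 1) * (h / M₂)),
    (NormedSpace.exp ((h - τ) • G.A) * G.B₂) a c.2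

/-- The block row `i` is `C₂ e^{(ih/M₁)A}`. -/
def Ch (h : ℝ) (M₁ : ℕ) : Matrix (Fin M₁ × Fin ny) (Fin n) ℝ :=
  Matrix.of fun r a => (G.C₂ * NormedSpace.exp (((r.1 : ℝ) * (h / M₁)) • G.A)) r.2 a

/-- The block `(i, j)` is the integral of `C₂ e^{(ih/M₁-τ)A} B₂` over the part of
`[jh/M₂, (j+1)h/M₂)` that precedes `ih/M₁`. -/
def Dh (h : ℝ) (M₁ M₂ : ℕ) : Matrix (Fin M₁ × Fin ny) (Fin M₂ × Fin nu) ℝ :=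
  Matrix.of fun r c =>
    ∫ τ in Set.Ico 0 ((r.1 : ℝ) * (h / M₁)) ∩
        Set.Ico ((c.1 : ℝ) * (h / M₂)) (((c.1 : ℝ) + 1) * (h / M₂)),
      (G.C₂ * NormedSpace.exp (((r.1 : ℝ) * (h / M₁) - τ) • G.A) * G.B₂) r.2 c.2

/-- The feedback loop is well-posed: `I - Dh D_K` is invertible. -/
def WellPosed (h : ℝ) (M₁ M₂ : ℕ)
    (K : Controller (Fin nk) (Fin M₁ × Fin ny) (Fin M₂ × Fin nu)) : Prop :=
  IsUnit (1 - G.Dh h M₁ M₂ * K.D).det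

/-- The state matrix, over one period `h`, of the feedback loop of the plant with the lifted
controller `ξ[k+1] = A_K ξ[k] + B_K y_d[k], u_d[k] = C_K ξ[k] + D_K y_d[k]`. It comes from
`y_d = (I - Dh D_K)⁻¹ (Ch x + Dh C_K ξ)`. -/
def closedLoop (h : ℝ) (M₁ M₂ : ℕ)
    (K : Controller (Fin nk) (Fin M₁ × Fin ny) (Fin M₂ × Fin nu)) :
    Matrix (Fin n ⊕ Fin nk) (Fin n ⊕ Fin nk) ℝ :=
  let E := (1 - G.Dh h M₁ M₂ * K.D)⁻¹
  Matrix.fromBlocks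
    (G.Ah h + G.Bh h M₂ * K.D * E * G.Ch h M₁)
    (G.Bh h M₂ * (K.C + K.D * E * G.Dh h M₁ M₂ * K.C))
    (K.B * E * G.Ch h M₁)
    (K.A + K.B * E * G.Dh h M₁ M₂ * K.C)

/-- The closed-loop state matrix is power stable. -/
def Stable (h : ℝ) (M₁ M₂ : ℕ)
    (K : Controller (Fin nk) (Fin M₁ × Fin ny) (Fin M₂ × Fin nu)) : Prop :=
  Tendsto (fun k : ℕ => G.closedLoop h M₁ M₂ K ^ k) atTop (𝓝 0)

/-! #### The multirate system and its fast-sampling/fast-hold discretization -/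

/-- The held and sampled controller `H_{h/M₂} 𝒦 S_{h/M₁}`. -/
def heldController (h : ℝ) (M₁ M₂ : ℕ)
    (K : (ℕ → EuclideanSpace ℝ (Fin ny)) → (ℕ → EuclideanSpace ℝ (Fin nu))) :
    (ℝ → EuclideanSpace ℝ (Fin ny)) → (ℝ → EuclideanSpace ℝ (Fin nu)) :=
  fun y => hold (h / M₂) (K (sampler (h / M₁) y))

/-- The multirate sampled-data system `𝒯 = F_l(G, H_{h/M₂} 𝒦 S_{h/M₁})`. -/
def multirate (h : ℝ) (M₁ M₂ : ℕ)
    (K : (ℕ → EuclideanSpace ℝ (Fin ny)) → (ℕ → EuclideanSpace ℝ (Fin nu))) :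
    (ℝ → EuclideanSpace ℝ (Fin nw)) → (ℝ → EuclideanSpace ℝ (Fin nz)) :=
  lft G.G₁₁ G.G₁₂ G.G₂₁ G.G₂₂ (heldController h M₁ M₂ K)

end Plant

/-- The time-invariant controller `K_d = L_{M₂} 𝒦 L_{M₁}⁻¹`. -/
def liftedController (M₁ M₂ : ℕ)
    (K : (ℕ → EuclideanSpace ℝ (Fin ny)) → (ℕ → EuclideanSpace ℝ (Fin nu))) :
    (ℕ → EuclideanSpace ℝ (Fin M₁ × Fin ny)) → (ℕ → EuclideanSpace ℝ (Fin M₂ × Fin nu)) :=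
  fun y => lift M₂ (K (unlift M₁ y))

/-- Discretization and lifting `L_P S_{h/P} Q H_{h/R} L_R⁻¹` of a continuous-time operator `Q`. -/
def discLift {m p : ℕ} (h : ℝ) (P R : ℕ)
    (Q : (ℝ → EuclideanSpace ℝ (Fin m)) → (ℝ → EuclideanSpace ℝ (Fin p))) :
    (ℕ → EuclideanSpace ℝ (Fin R × Fin m)) → (ℕ → EuclideanSpace ℝ (Fin P × Fin p)) :=
  fun v => lift P (sampler (h / P) (Q (hold (h / R) (unlift R v))))

/-- The fast-sampling/fast-hold approximation `T_{dN} = F_l(G̃_{dN}, K_d)`, where `G̃_{dN}` is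
`diag(L_N S_{h/N}, L_{M₁} S_{h/M₁}) · G · diag(H_{h/N} L_N⁻¹, H_{h/M₂} L_{M₂}⁻¹)`. -/
def Plant.fsfh (G : Plant n nw nu nz ny) (h : ℝ) (M₁ M₂ : ℕ)
    (K : (ℕ → EuclideanSpace ℝ (Fin ny)) → (ℕ → EuclideanSpace ℝ (Fin nu))) (N : ℕ) :
    (ℕ → EuclideanSpace ℝ (Fin N × Fin nw)) → (ℕ → EuclideanSpace ℝ (Fin N × Fin nz)) :=
  lft (discLift h N N G.G₁₁) (discLift h N M₂ G.G₁₂) (discLift h M₁ N G.G₂₁)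
    (discLift h M₁ M₂ G.G₂₂) (liftedController M₁ M₂ K)

end

end SampledData

/-! Let R be sampling followed by holding with period δ = h/N. Holding an unlifted sequence
multiplies its norm by √(h/N), on the input side and on the output side alike, and the discretized
loop contains exactly the lifted controller. Up to this common factor, T_dN is therefore the
operator R𝒯 on inputs that are constant on slots of length δ (`fsfh_eq`, `eLpNorm_hold_unlift`). Two
facts remain: such inputs become dense in L² (`eventually_exists_hold_close`), and on them ‖𝒯w −
R𝒯w‖ ≤ ε‖w‖, uniformly in w, once N is large (`eventually_resample_close`). Then ‖T_dN‖ ≤ ‖𝒯‖ + ε.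
Conversely, a nearly maximizing input of 𝒯 can be replaced by a held one, since 𝒯 is bounded, and
this gives the lower bound.

Sampling is unbounded on L², so the uniform estimate must come from the structure of the output C₁x
+ D₁₁w + D₁₂u. The term in w is fixed by R. Between samples, x changes by (e^{sA} − 1)x(kδ) plus a
convolution over a time at most δ, which is small relative to the energies of the samples and of the
forcing (`exists_resample_evol_bound`). The control u is held with the fixed period h/M₂, so Ru
differs from u only within δ of a jump (`lintegral_resample_hold_sq_le`).

All these energies are dominated by that of w through internal stability. Over one period the joint
state of plant and controller obeys a recursion with matrix A_cl, driven by terms that the energy of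
w on that period controls (`loopState_succ`), and a power stable recursion is ℓ²-bounded
(`exists_l2_bound`). For a held input the same recursion is a realization of T_dN, with A_cl
independent of N.

The loop itself is solvable because the controller sees y only through its samples: the
continuous-time equation reduces to the lifted one, which is solved one step at a time by inverting
I − D_h D_K. -/

open scoped NNReal

namespace SampledData

noncomputable section

/-! ### Matrices as operators; the flow of the plant -/

section LinearMaps

variable {ι κ σ : Type*} [Fintype ι] [DecidableEq ι] [Fintype κ]
  [Fintype σ] [DecidableEq σ]

/-- The continuous linear map of a real matrix between Euclidean spaces. -/
def mat (M : Matrix κ ι ℝ) : EuclideanSpace ℝ ι →L[ℝ] EuclideanSpace ℝ κ :=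
  LinearMap.toContinuousLinearMap (Matrix.toEuclideanLin M)

lemma toEuclideanLin_eq_mat (M : Matrix κ ι ℝ) (v : EuclideanSpace ℝ ι) :
    Matrix.toEuclideanLin M v = mat M v := rfl

lemma mat_coord (M : Matrix κ ι ℝ) (v : EuclideanSpace ℝ ι) (a : κ) :
    mat M v a = ∑ b, M a b * v b := rfl

lemma mat_mul (M : Matrix κ σ ℝ) (M' : Matrix σ ι ℝ) (v : EuclideanSpace ℝ ι) :
    mat (M * M') v = mat M (mat M' v) := by
  ext a
  simp [mat, Matrix.toLpLin_apply]

lemma mat_add (M M' : Matrix κ ι ℝ) (v : EuclideanSpace ℝ ι) :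
    mat (M + M') v = mat M v + mat M' v := by
  ext a; simp [mat]

lemma mat_sub (M M' : Matrix κ ι ℝ) (v : EuclideanSpace ℝ ι) :
    mat (M - M') v = mat M v - mat M' v := by
  ext a; simp [mat]

lemma mat_zero (v : EuclideanSpace ℝ ι) : mat (0 : Matrix κ ι ℝ) v = 0 := by
  ext a; simp [mat]

lemma mat_one (v : EuclideanSpace ℝ ι) : mat (1 : Matrix ι ι ℝ) v = v := by
  ext a; simp [mat]

lemma mat_pow (M : Matrix ι ι ℝ) (k : ℕ) : mat (M ^ k) = mat M ^ k := by
  induction k with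
  | zero => ext v : 1; simp [mat_one]
  | succ k ih => ext v : 1; rw [pow_succ, pow_succ, mat_mul, ih]; rfl

lemma exists_mat (f : EuclideanSpace ℝ ι →ₗ[ℝ] EuclideanSpace ℝ κ) :
    ∃ M : Matrix κ ι ℝ, ∀ v, mat M v = f v :=
  ⟨Matrix.toEuclideanLin.symm f, fun v => by simp [mat]⟩

lemma continuous_mat : Continuous (mat : Matrix κ ι ℝ → _) := by
  let f : Matrix κ ι ℝ →ₗ[ℝ] (EuclideanSpace ℝ ι →L[ℝ] EuclideanSpace ℝ κ) :=
    (LinearMap.toContinuousLinearMap (𝕜 := ℝ)).toLinearMap ∘ₗ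
      (Matrix.toEuclideanLin (𝕜 := ℝ)).toLinearMap
  exact f.continuous_of_finiteDimensional

/-- The flow `t ↦ e^{tA}` of `ẋ = A x`. -/
def flow (A : Matrix ι ι ℝ) (t : ℝ) : EuclideanSpace ℝ ι →L[ℝ] EuclideanSpace ℝ ι :=
  mat (NormedSpace.exp (t • A))

lemma continuous_exp_smul (A : Matrix ι ι ℝ) :
    Continuous fun t : ℝ => NormedSpace.exp (t • A) := by
  let _ : NormedRing (Matrix ι ι ℝ) := Matrix.linftyOpNormedRing
  let _ : NormedAlgebra ℝ (Matrix ι ι ℝ) := Matrix.linftyOpNormedAlgebra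
  let _ : NormedAlgebra ℚ (Matrix ι ι ℝ) := NormedAlgebra.restrictScalars ℚ ℝ _
  exact NormedSpace.exp_continuous.comp (continuous_id.smul continuous_const)

lemma continuous_flow (A : Matrix ι ι ℝ) : Continuous (flow A) :=
  continuous_mat.comp (continuous_exp_smul A)

lemma flow_zero (A : Matrix ι ι ℝ) (v : EuclideanSpace ℝ ι) : flow A 0 v = v := by
  simp [flow, mat_one]

lemma flow_add (A : Matrix ι ι ℝ) (s t : ℝ) (v : EuclideanSpace ℝ ι) :
    flow A (s + t) v = flow A s (flow A t v) := by
  rw [flow, add_smul, Matrix.exp_add_of_commute, mat_mul]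
  · rfl
  · exact (Commute.refl A).smul_left s |>.smul_right t

lemma exists_norm_flow_le (A : Matrix ι ι ℝ) (h : ℝ) :
    ∃ C : ℝ, 0 < C ∧ ∀ s, 0 ≤ s → s ≤ h → ‖flow A s‖ ≤ C := by
  obtain ⟨C, hC⟩ := (isCompact_Icc (a := (0 : ℝ)) (b := h)).exists_bound_of_continuousOn
    (continuous_flow A).continuousOn
  exact ⟨max C 1, by positivity, fun s h0 h1 => (hC s ⟨h0, h1⟩).trans (le_max_left _ _)⟩

end LinearMaps

/-! ### Variation of constants for locally integrable forcing -/

section Evolution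

variable {ι : Type*} [Fintype ι] [DecidableEq ι]
variable {E F : Type*} [NormedAddCommGroup E] [NormedAddCommGroup F]

/-- Integrability on each bounded interval `[0, t]`. -/
def LocInt (f : ℝ → E) : Prop := ∀ t, 0 ≤ t → IntervalIntegrable f volume 0 t

lemma LocInt.interval {f : ℝ → E} (hf : LocInt f) {a b : ℝ} (ha : 0 ≤ a) (hb : 0 ≤ b) :
    IntervalIntegrable f volume a b := (hf a ha).symm.trans (hf b hb)

lemma LocInt.add {f g : ℝ → E} (hf : LocInt f) (hg : LocInt g) :
    LocInt (f + g) := fun t ht => (hf t ht).add (hg t ht)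

lemma LocInt.shift {f : ℝ → E} (hf : LocInt f) {a : ℝ} (ha : 0 ≤ a) :
    LocInt (fun t => f (a + t)) := fun t ht => by
  have := (hf.interval ha (add_nonneg ha ht)).comp_add_left a
  simpa using this

variable [NormedSpace ℝ E] [NormedSpace ℝ F]

lemma LocInt.clm {f : ℝ → E} (hf : LocInt f) (L : E →L[ℝ] F) :
    LocInt (fun t => L (f t)) := fun t ht =>
  ⟨L.integrable_comp (hf t ht).1, L.integrable_comp (hf t ht).2⟩

/-- A continuous family of operators applied to an integrable function. -/
lemma intervalIntegrable_clm_apply {S : ℝ → E →L[ℝ] F} (hS : Continuous S) {f : ℝ → E} {a b : ℝ}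
    (hf : IntervalIntegrable f volume a b) :
    IntervalIntegrable (fun τ => S τ (f τ)) volume a b := by
  obtain ⟨C, hC⟩ := (isCompact_uIcc (a := a) (b := b)).exists_bound_of_continuousOn
    hS.continuousOn
  rw [intervalIntegrable_iff] at hf ⊢
  refine Integrable.mono' (hf.norm.const_mul C)
    ((ContinuousLinearMap.id ℝ (E →L[ℝ] F)).aestronglyMeasurable_comp₂
      hS.aestronglyMeasurable hf.aestronglyMeasurable) ?_
  refine (ae_restrict_iff' measurableSet_uIoc).2 (ae_of_all _ fun τ hτ => ?_)
  exact (S τ).le_of_opNorm_le (hC τ (Set.uIoc_subset_uIcc hτ)) _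

/-- The solution `∫₀ᵗ e^{(t-τ)A} f(τ) dτ` of `ẋ = A x + f, x(0) = 0`. -/
def evol (A : Matrix ι ι ℝ) (f : ℝ → EuclideanSpace ℝ ι) (t : ℝ) : EuclideanSpace ℝ ι :=
  ∫ τ in (0 : ℝ)..t, flow A (t - τ) (f τ)

variable {A : Matrix ι ι ℝ} {f g : ℝ → EuclideanSpace ℝ ι}

lemma intervalIntegrable_flow (A : Matrix ι ι ℝ) (t : ℝ) {a b : ℝ}
    (hf : IntervalIntegrable f volume a b) :
    IntervalIntegrable (fun τ => flow A (t - τ) (f τ)) volume a b :=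
  intervalIntegrable_clm_apply ((continuous_flow A).comp (continuous_const.sub continuous_id)) hf

lemma evol_zero : evol A f 0 = 0 := by simp [evol]

lemma evol_add_fun (hf : LocInt f) (hg : LocInt g) {t : ℝ} (ht : 0 ≤ t) :
    evol A (fun τ => f τ + g τ) t = evol A f t + evol A g t := by
  simp only [evol, map_add]
  exact intervalIntegral.integral_add (intervalIntegrable_flow A t (hf t ht))
    (intervalIntegrable_flow A t (hg t ht))

lemma evol_const_smul (c : ℝ) (t : ℝ) :
    evol A (fun τ => c • f τ) t = c • evol A f t := by
  simp only [evol, map_smul]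
  exact intervalIntegral.integral_smul c _

/-- The endpoint `t` is a null set. Leaving it out matters, because a held signal already takes its
next value there. -/
lemma evol_congr {t : ℝ} (ht : 0 ≤ t) (hfg : ∀ τ, 0 ≤ τ → τ < t → f τ = g τ) :
    evol A f t = evol A g t := by
  refine intervalIntegral.integral_congr_ae ?_
  have : ∀ᵐ τ : ℝ, τ ≠ t := by simp [ae_iff]
  filter_upwards [this] with τ hτ hτ'
  rw [Set.uIoc_of_le ht] at hτ'
  rw [hfg τ hτ'.1.le (lt_of_le_of_ne hτ'.2 hτ)]

/-- Splitting the integral at `a` and using the semigroup law restarts the evolution from the state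
reached at time `a`. -/
lemma evol_shift (hf : LocInt f) {a s : ℝ} (ha : 0 ≤ a) (hs : 0 ≤ s) :
    evol A f (a + s) = flow A s (evol A f a) + evol A (fun τ => f (a + τ)) s := by
  rw [evol, ← intervalIntegral.integral_add_adjacent_intervals (b := a)
    (intervalIntegrable_flow A _ (hf a ha))
    (intervalIntegrable_flow A _ (hf.interval ha (add_nonneg ha hs)))]
  congr 1
  · rw [evol, ← ContinuousLinearMap.intervalIntegral_comp_comm _
      (intervalIntegrable_flow A _ (hf a ha))]
    refine intervalIntegral.integral_congr fun τ _ => ?_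
    rw [← flow_add]
    congr 2; ring
  · rw [evol]
    have := intervalIntegral.integral_comp_add_left
      (fun τ => flow A (a + s - τ) (f τ)) a (a := 0) (b := s)
    simp only [add_zero] at this
    rw [← this]
    refine intervalIntegral.integral_congr fun τ _ => ?_
    congr 2; ring

lemma enorm_evol_le {h C : ℝ} (hC : ∀ s, 0 ≤ s → s ≤ h → ‖flow A s‖ ≤ C) {s : ℝ}
    (hs : 0 ≤ s) (hsh : s ≤ h) :
    ‖evol A f s‖ₑ ≤ ENNReal.ofReal C * ∫⁻ τ in Set.Ico 0 s, ‖f τ‖ₑ := by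
  rw [evol, intervalIntegral.integral_of_le hs, ← integral_Ico_eq_integral_Ioc,
    ← lintegral_const_mul' _ _ ENNReal.ofReal_ne_top]
  refine (enorm_integral_le_lintegral_enorm _).trans (setLIntegral_mono' measurableSet_Ico ?_)
  intro τ hτ
  rw [← ofReal_norm, ← ofReal_norm, ← ENNReal.ofReal_mul'  (norm_nonneg _)]
  exact ENNReal.ofReal_le_ofReal ((flow A (s - τ)).le_of_opNorm_le
    (hC _ (by linarith [hτ.2]) (by linarith [hτ.1])) _)

/-- Factoring e^{tA} out of the integral leaves an integrand independent of `t`, whose primitive is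
continuous. This makes the plant state measurable. -/
lemma continuousOn_evol (hf : LocInt f) : ContinuousOn (evol A f) (Set.Ici 0) := by
  have key : ∀ R, 0 ≤ R → ContinuousOn (evol A f) (Set.Icc 0 R) := by
    intro R hR
    have h1 : ContinuousOn (fun t => flow A t (∫ τ in (0 : ℝ)..t, flow A (0 - τ) (f τ)))
        (Set.Icc 0 R) := by
      refine (continuous_flow A).continuousOn.clm_apply ?_
      have := intervalIntegral.continuousOn_primitive_interval
        (f := fun τ => flow A (0 - τ) (f τ)) (a := 0) (b := R) (μ := volume) (by
          have := (intervalIntegrable_flow A 0 (hf R hR))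
          rw [Set.uIcc_of_le hR, integrableOn_Icc_iff_integrableOn_Ioc]
          rwa [intervalIntegrable_iff_integrableOn_Ioc_of_le hR] at this)
      rwa [Set.uIcc_of_le hR] at this
    refine h1.congr fun t ht => ?_
    simp only
    rw [← ContinuousLinearMap.intervalIntegral_comp_comm _
      (intervalIntegrable_flow A _ (hf t ht.1)), evol]
    refine intervalIntegral.integral_congr fun τ _ => ?_
    rw [← flow_add]; congr 2; ring
  intro t ht
  have := key (t + 1) (by linarith [Set.mem_Ici.1 ht]) t ⟨ht, by linarith⟩
  refine this.mono_of_mem_nhdsWithin ?_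
  rw [mem_nhdsWithin]
  exact ⟨Set.Iio (t + 1), isOpen_Iio, by simp, fun s hs => ⟨hs.2, hs.1.le⟩⟩

lemma contSys_eq {n m p : ℕ} (A : Matrix (Fin n) (Fin n) ℝ) (B : Matrix (Fin n) (Fin m) ℝ)
    (C : Matrix (Fin p) (Fin n) ℝ) (D : Matrix (Fin p) (Fin m) ℝ)
    {w : ℝ → EuclideanSpace ℝ (Fin m)} (hw : LocInt w) {t : ℝ} (ht : 0 ≤ t) :
    contSys A B C D w t = mat C (evol A (fun τ => mat B (w τ)) t) + mat D (w t) := by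
  rw [contSys, evol, ← ContinuousLinearMap.intervalIntegral_comp_comm _
      (intervalIntegrable_flow A _ (hw.clm (mat B) t ht))]
  simp only [toEuclideanLin_eq_mat, mat_mul]
  rfl

end Evolution

/-! ### Lifting, and held signals over one period -/

section Lifting

variable {m p : ℕ}

/-- The stacked vector of `M` vectors. -/
def stack {M : ℕ} (F : Fin M → EuclideanSpace ℝ (Fin p)) : EuclideanSpace ℝ (Fin M × Fin p) :=
  WithLp.toLp 2 fun c => F c.1 c.2

lemma lift_apply (N : ℕ) (v : ℕ → EuclideanSpace ℝ (Fin m)) (k : ℕ) :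
    lift N v k = stack fun i : Fin N => v (k * N + i) := rfl

lemma stack_apply {M : ℕ} (F : Fin M → EuclideanSpace ℝ (Fin p)) (c : Fin M × Fin p) :
    stack F c = F c.1 c.2 := rfl

lemma stack_add {M : ℕ} (F F' : Fin M → EuclideanSpace ℝ (Fin p)) :
    stack (fun i => F i + F' i) = stack F + stack F' := rfl

lemma enorm_stack_sq {M : ℕ} (F : Fin M → EuclideanSpace ℝ (Fin p)) :
    ‖stack F‖ₑ ^ 2 = ∑ i, ‖F i‖ₑ ^ 2 := by
  have h1 : ‖stack F‖ ^ 2 = ∑ i, ‖F i‖ ^ 2 := by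
    simp only [EuclideanSpace.norm_sq_eq, Fintype.sum_prod_type, stack_apply]
  simp only [← ofReal_norm, ← ENNReal.ofReal_pow (norm_nonneg _)]
  rw [h1, ENNReal.ofReal_sum_of_nonneg fun _ _ => by positivity]

lemma lift_unlift {N : ℕ} (hN : 0 < N) (v : ℕ → EuclideanSpace ℝ (Fin N × Fin m)) :
    lift N (unlift N v) = v := by
  funext k
  ext ⟨i, c⟩
  have h1 : (k * N + i) / N = k := by
    rw [mul_comm, Nat.mul_add_div hN, Nat.div_eq_of_lt i.2, add_zero]
  simp [lift, unlift, hN, h1, Nat.mod_eq_of_lt i.2]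

lemma unlift_lift {N : ℕ} (hN : 0 < N) (v : ℕ → EuclideanSpace ℝ (Fin m)) :
    unlift N (lift N v) = v := by
  funext i
  ext c
  simp [lift, unlift, hN, Nat.div_add_mod']

lemma unlift_add (N : ℕ) (v w : ℕ → EuclideanSpace ℝ (Fin N × Fin m)) :
    unlift N (v + w) = unlift N v + unlift N w := by
  funext i; ext c
  by_cases hN : 0 < N <;> simp [unlift, hN]

lemma unlift_smul (N : ℕ) (a : ℝ) (v : ℕ → EuclideanSpace ℝ (Fin N × Fin m)) :
    unlift N (a • v) = a • unlift N v := by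
  funext i; ext c
  by_cases hN : 0 < N <;> simp [unlift, hN]

lemma lift_add (N : ℕ) (v w : ℕ → EuclideanSpace ℝ (Fin m)) :
    lift N (v + w) = lift N v + lift N w := rfl

lemma lift_sampler {h : ℝ} {N : ℕ} (hN : 0 < N) (z : ℝ → EuclideanSpace ℝ (Fin m)) (k : ℕ) :
    lift N (sampler (h / N) z) k = stack fun i : Fin N => z (k * h + i * (h / N)) := by
  rw [lift_apply]
  congr 1; funext i
  have : (N : ℝ) ≠ 0 := by positivity
  simp only [sampler]
  congr 1; push_cast; field_simp

lemma slot_time_nonneg {h : ℝ} (hh : 0 < h) {N : ℕ} (i : Fin N) : 0 ≤ (i : ℝ) * (h / N) := by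
  positivity

lemma slot_time_lt {h : ℝ} (hh : 0 < h) {N : ℕ} (i : Fin N) : (i : ℝ) * (h / N) < h := by
  have hN : (0 : ℝ) < N := by exact_mod_cast i.pos
  rw [mul_div_assoc', div_lt_iff₀ hN, mul_comm]
  have : (i : ℝ) < N := by exact_mod_cast i.2
  exact mul_lt_mul_of_pos_left this hh

/-- One period of a held signal: the value on the `j`-th of `N` slots of `[0, h)` is the `j`-th
block of `q`. -/
def cell (h : ℝ) (N : ℕ) (q : EuclideanSpace ℝ (Fin N × Fin m)) :
    ℝ → EuclideanSpace ℝ (Fin m) :=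
  hold (h / N) (unlift N fun _ => q)

lemma floor_slot_lt {h : ℝ} (hh : 0 < h) {N : ℕ} (hN : 0 < N) {s : ℝ} (hs : 0 ≤ s)
    (hsh : s < h) : ⌊s / (h / N)⌋₊ < N := by
  have hN' : (0 : ℝ) < N := by exact_mod_cast hN
  rw [Nat.floor_lt (by positivity), div_lt_iff₀ (by positivity)]
  field_simp
  exact hsh

lemma floor_period_add {h : ℝ} (hh : 0 < h) {N : ℕ} (hN : 0 < N) (k : ℕ) {s : ℝ} (hs : 0 ≤ s) :
    ⌊(k * h + s) / (h / N)⌋₊ = k * N + ⌊s / (h / N)⌋₊ := by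
  have hN' : (0 : ℝ) < N := by exact_mod_cast hN
  have : (k * h + s) / (h / N) = ((k * N : ℕ) : ℝ) + s / (h / N) := by
    push_cast; field_simp
  rw [this, add_comm, Nat.floor_add_natCast (by positivity), add_comm]

/-- The N slots tile a period exactly, so within period `k` the held signal depends only on the
`k`-th lifted vector. This makes the loop time-invariant from period to period. -/
lemma hold_unlift_period {h : ℝ} (hh : 0 < h) {N : ℕ} (hN : 0 < N)
    (v : ℕ → EuclideanSpace ℝ (Fin N × Fin m)) (k : ℕ) {s : ℝ} (hs : 0 ≤ s) (hsh : s < h) :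
    hold (h / N) (unlift N v) (k * h + s) = cell h N (v k) s := by
  have hlt := floor_slot_lt hh hN hs hsh
  have h1 : (k * N + ⌊s / (h / N)⌋₊) / N = k := by
    rw [mul_comm, Nat.mul_add_div hN, Nat.div_eq_of_lt hlt, add_zero]
  have h2 : (k * N + ⌊s / (h / N)⌋₊) % N = ⌊s / (h / N)⌋₊ := by
    rw [mul_comm, Nat.mul_add_mod, Nat.mod_eq_of_lt hlt]
  ext c
  simp [cell, hold, unlift, hN, floor_period_add hh hN k hs, h1, h2, Nat.mod_eq_of_lt hlt]

lemma cell_apply {h : ℝ} (hh : 0 < h) {N : ℕ} (hN : 0 < N) (q : EuclideanSpace ℝ (Fin N × Fin m))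
    {s : ℝ} (hs : 0 ≤ s) (hsh : s < h) (c : Fin m) :
    cell h N q s c = q (⟨⌊s / (h / N)⌋₊, floor_slot_lt hh hN hs hsh⟩, c) := by
  simp [cell, hold, unlift, hN, Nat.mod_eq_of_lt (floor_slot_lt hh hN hs hsh)]

lemma cell_add (h : ℝ) (N : ℕ) (q q' : EuclideanSpace ℝ (Fin N × Fin m)) (s : ℝ) :
    cell h N (q + q') s = cell h N q s + cell h N q' s := by
  have : (fun _ : ℕ => q + q') = (fun _ => q) + fun _ => q' := rfl
  simp only [cell, hold]
  rw [this, unlift_add]; rfl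

lemma cell_smul (h : ℝ) (N : ℕ) (a : ℝ) (q : EuclideanSpace ℝ (Fin N × Fin m)) (s : ℝ) :
    cell h N (a • q) s = a • cell h N q s := by
  have : (fun _ : ℕ => a • q) = a • (fun _ => q) := rfl
  simp only [cell, hold]
  rw [this, unlift_smul]; rfl

lemma stronglyMeasurable_hold {E : Type*} [TopologicalSpace E] (δ : ℝ) (v : ℕ → E) :
    StronglyMeasurable (hold δ v) :=
  (StronglyMeasurable.of_discrete (f := v)).comp_measurable
    (Nat.measurable_floor.comp (measurable_id.div_const δ))

lemma locInt_hold {E : Type*} [NormedAddCommGroup E] {δ : ℝ} (hδ : 0 < δ) (v : ℕ → E) :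
    LocInt (hold δ v) := by
  intro t ht
  rw [intervalIntegrable_iff_integrableOn_Ioc_of_le ht]
  refine Measure.integrableOn_of_bounded (M := ∑ i ∈ Finset.range (⌊t / δ⌋₊ + 1), ‖v i‖)
    (by simp) (stronglyMeasurable_hold δ v).aestronglyMeasurable ?_
  refine (ae_restrict_iff' measurableSet_Ioc).2 (ae_of_all _ fun τ hτ => ?_)
  refine Finset.single_le_sum (f := fun i => ‖v i‖) (fun _ _ => norm_nonneg _) ?_
  rw [Finset.mem_range, Nat.lt_succ_iff]
  exact Nat.floor_le_floor (by have := hτ.2; gcongr)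

lemma locInt_cell {h : ℝ} (hh : 0 < h) {N : ℕ} (hN : 0 < N)
    (q : EuclideanSpace ℝ (Fin N × Fin m)) : LocInt (cell h N q) :=
  locInt_hold (by positivity) _

/-- The signal is constant on each slot, so the integral is a sum over slots; intersecting with `[0,
s)` accounts for the slot cut off by `s`. The entries of `Bh` and `Dh` are such integrals. -/
lemma integral_cell {κ : Type*} [Fintype κ] {h : ℝ} (hh : 0 < h) {N : ℕ} (hN : 0 < N)
    {M : ℝ → Matrix κ (Fin m) ℝ} (hM : Continuous M) (q : EuclideanSpace ℝ (Fin N × Fin m))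
    {s : ℝ} (hs : 0 ≤ s) (hsh : s ≤ h) (a : κ) :
    (∫ τ in (0 : ℝ)..s, mat (M τ) (cell h N q τ)) a =
      ∑ c, (∫ τ in Set.Ico 0 s ∩ Set.Ico ((c.1 : ℝ) * (h / N)) (((c.1 : ℝ) + 1) * (h / N)),
        M τ a c.2) * q c := by
  have hδ : 0 < h / N := by positivity
  have hint := intervalIntegrable_clm_apply (continuous_mat.comp hM) (locInt_cell hh hN q s hs)
  have hproj := ContinuousLinearMap.intervalIntegral_comp_comm
    (EuclideanSpace.proj a : EuclideanSpace ℝ κ →L[ℝ] ℝ) hint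
  simp only [EuclideanSpace.coe_proj, Function.comp_apply] at hproj
  rw [← hproj, intervalIntegral.integral_of_le hs, ← integral_Ico_eq_integral_Ioc]
  have hMa : ∀ b, Continuous fun τ => M τ a b := fun b => hM.matrix_elem a b
  calc ∫ τ in Set.Ico 0 s, mat (M τ) (cell h N q τ) a
      = ∫ τ in Set.Ico 0 s, ∑ c : Fin N × Fin m,
          (Set.Ico ((c.1 : ℝ) * (h / N)) (((c.1 : ℝ) + 1) * (h / N))).indicator
            (fun τ => M τ a c.2 * q c) τ := by
        refine setIntegral_congr_fun measurableSet_Ico fun τ hτ => ?_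
        have hτh : τ < h := hτ.2.trans_le hsh
        simp only [mat_coord]
        rw [Fintype.sum_prod_type, Finset.sum_comm]
        refine Finset.sum_congr rfl fun b _ => ?_
        rw [cell_apply hh hN q hτ.1 hτh]
        set j : Fin N := ⟨⌊τ / (h / N)⌋₊, floor_slot_lt hh hN hτ.1 hτh⟩ with hj
        rw [Finset.sum_eq_single j]
        · rw [Set.indicator_of_mem]
          refine ⟨?_, ?_⟩
          · rw [← le_div_iff₀ hδ]
            exact Nat.floor_le (div_nonneg hτ.1 hδ.le)
          · rw [← div_lt_iff₀ hδ]
            exact Nat.lt_floor_add_one _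
        · intro i _ hij
          refine Set.indicator_of_notMem (fun hmem => hij ?_) _
          rw [Set.mem_Ico, ← le_div_iff₀ hδ, ← div_lt_iff₀ hδ] at hmem
          ext
          exact ((Nat.floor_eq_iff (div_nonneg hτ.1 hδ.le)).2 hmem).symm
        · simp
    _ = _ := by
        rw [integral_finsetSum]
        · refine Finset.sum_congr rfl fun c _ => ?_
          rw [setIntegral_indicator measurableSet_Ico, integral_mul_const]
        · intro c _
          refine Integrable.indicator ?_ measurableSet_Ico
          exact (((hMa c.2).mul continuous_const).continuousOn.integrableOn_Icc).mono_set
            Set.Ico_subset_Icc_self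

end Lifting

/-! ### The one-period plant matrices as evolutions -/

section Periods

variable {n nw nu nz ny : ℕ} (G : Plant n nw nu nz ny)

lemma continuous_mat_exp (A : Matrix (Fin n) (Fin n) ℝ) (s : ℝ) :
    Continuous fun τ : ℝ => NormedSpace.exp ((s - τ) • A) :=
  (continuous_exp_smul A).comp (continuous_const.sub continuous_id)

lemma mat_Bh {h : ℝ} (hh : 0 < h) {M₂ : ℕ} (hM₂ : 0 < M₂)
    (q : EuclideanSpace ℝ (Fin M₂ × Fin nu)) :
    mat (G.Bh h M₂) q = evol G.A (fun τ => mat G.B₂ (cell h M₂ q τ)) h := by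
  have hM : (0 : ℝ) < M₂ := by exact_mod_cast hM₂
  ext a
  have := integral_cell hh hM₂ ((continuous_mat_exp G.A h).matrix_mul continuous_const
    (B := fun _ => G.B₂)) q hh.le le_rfl a
  simp only [mat_mul] at this
  rw [evol]
  simp only [flow]
  rw [this, mat_coord]
  refine Finset.sum_congr rfl fun c _ => ?_
  congr 1
  simp only [Plant.Bh, Matrix.of_apply]
  have hc1 := slot_time_nonneg hh c.1
  have hc2 : ((c.1 : ℝ) + 1) * (h / M₂) ≤ h := by
    rw [mul_div_assoc', div_le_iff₀ hM, mul_comm]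
    have : (c.1 : ℝ) + 1 ≤ M₂ := by exact_mod_cast c.1.2
    exact mul_le_mul_of_nonneg_left this hh.le
  have hc3 : (c.1 : ℝ) * (h / M₂) ≤ ((c.1 : ℝ) + 1) * (h / M₂) := by gcongr; linarith
  rw [intervalIntegral.integral_of_le hc3, ← integral_Ico_eq_integral_Ioc, Set.inter_eq_right.2]
  exact Set.Ico_subset_Ico hc1 hc2

lemma mat_Dh {h : ℝ} (hh : 0 < h) {M₁ M₂ : ℕ} (hM₂ : 0 < M₂)
    (q : EuclideanSpace ℝ (Fin M₂ × Fin nu)) :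
    mat (G.Dh h M₁ M₂) q = stack fun i : Fin M₁ =>
      mat G.C₂ (evol G.A (fun τ => mat G.B₂ (cell h M₂ q τ)) (i * (h / M₁))) := by
  ext r
  have hr := slot_time_nonneg hh r.1
  have := integral_cell hh hM₂ ((continuous_const (y := G.C₂)).matrix_mul
    (continuous_mat_exp G.A (r.1 * (h / M₁))) |>.matrix_mul continuous_const
    (B := fun _ => G.B₂)) q hr (slot_time_lt hh r.1).le r.2
  simp only [mat_mul] at this
  rw [stack_apply, evol, ← ContinuousLinearMap.intervalIntegral_comp_comm _
    (intervalIntegrable_flow _ _ (((locInt_cell hh hM₂ q).clm _) _ hr))]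
  simp only [flow]
  rw [this, mat_coord]
  rfl

lemma mat_Ch (h : ℝ) (M₁ : ℕ) (x : EuclideanSpace ℝ (Fin n)) :
    mat (G.Ch h M₁) x = stack fun i : Fin M₁ => mat G.C₂ (flow G.A (i * (h / M₁)) x) := by
  ext r
  rw [stack_apply, flow, ← mat_mul]
  rfl

end Periods

section Pair

variable {σ τ : Type*}

/-- The state of a feedback loop as one vector. -/
def pair (x : EuclideanSpace ℝ σ) (ξ : EuclideanSpace ℝ τ) : EuclideanSpace ℝ (σ ⊕ τ) :=
  WithLp.toLp 2 (Sum.elim x ξ)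

lemma pair_add (x x' : EuclideanSpace ℝ σ) (ξ ξ' : EuclideanSpace ℝ τ) :
    pair (x + x') (ξ + ξ') = pair x ξ + pair x' ξ' := by
  ext (i | i) <;> rfl

variable [Fintype σ] [Fintype τ]

lemma norm_pair_sq (x : EuclideanSpace ℝ σ) (ξ : EuclideanSpace ℝ τ) :
    ‖pair x ξ‖ ^ 2 = ‖x‖ ^ 2 + ‖ξ‖ ^ 2 := by
  simp [EuclideanSpace.norm_sq_eq, pair]

variable [DecidableEq σ] [DecidableEq τ]

lemma mat_fromBlocks (M₁₁ : Matrix σ σ ℝ) (M₁₂ : Matrix σ τ ℝ) (M₂₁ : Matrix τ σ ℝ)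
    (M₂₂ : Matrix τ τ ℝ) (x : EuclideanSpace ℝ σ) (ξ : EuclideanSpace ℝ τ) :
    mat (Matrix.fromBlocks M₁₁ M₁₂ M₂₁ M₂₂) (pair x ξ) =
      pair (mat M₁₁ x + mat M₁₂ ξ) (mat M₂₁ x + mat M₂₂ ξ) := by
  ext (i | i) <;> simp [mat_coord, pair]

end Pair

/-! ### Well-posedness of a discrete-time feedback loop -/

section DiscreteLoop

variable {σ τ ι κ : Type*} [Fintype σ] [DecidableEq σ] [Fintype τ] [DecidableEq τ]
  [Fintype ι] [DecidableEq ι] [Fintype κ]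

lemma discState_succ (A : Matrix σ σ ℝ) (B : Matrix σ ι ℝ) (v : ℕ → EuclideanSpace ℝ ι) (k : ℕ) :
    discState A B v (k + 1) = mat A (discState A B v k) + mat B (v k) := rfl

lemma discSys_apply (A : Matrix σ σ ℝ) (B : Matrix σ ι ℝ) (C : Matrix κ σ ℝ) (D : Matrix κ ι ℝ)
    (v : ℕ → EuclideanSpace ℝ ι) (k : ℕ) :
    discSys A B C D v k = mat C (discState A B v k) + mat D (v k) := rfl

lemma discState_add (A : Matrix σ σ ℝ) (B : Matrix σ ι ℝ) (v w : ℕ → EuclideanSpace ℝ ι) (k : ℕ) :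
    discState A B (v + w) k = discState A B v k + discState A B w k := by
  induction k with
  | zero => simp [discState]
  | succ k ih =>
    simp only [discState_succ, ih, Pi.add_apply, map_add]
    abel

lemma discSys_add (A : Matrix σ σ ℝ) (B : Matrix σ ι ℝ) (C : Matrix κ σ ℝ) (D : Matrix κ ι ℝ)
    (v w : ℕ → EuclideanSpace ℝ ι) :
    discSys A B C D (v + w) = discSys A B C D v + discSys A B C D w := by
  funext k
  simp only [discSys_apply, discState_add, Pi.add_apply, map_add]
  abel

variable [DecidableEq κ]

/-- The loop equation at a single instant: with `a` and `c` the contributions of the two states,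
only the feedthroughs act on `y`, so solving it is inverting `1 - Dp * D`. -/
lemma algebraic_loop_iff {Dp : Matrix ι κ ℝ} {D : Matrix κ ι ℝ} (hE : IsUnit (1 - Dp * D).det)
    (y a r : EuclideanSpace ℝ ι) (c : EuclideanSpace ℝ κ) :
    y - (a + mat Dp (c + mat D y)) = r ↔ y = mat (1 - Dp * D)⁻¹ (a + mat Dp c + r) := by
  have key : y - (a + mat Dp (c + mat D y)) = r ↔ mat (1 - Dp * D) y = a + mat Dp c + r := by
    rw [mat_sub, mat_one, mat_mul, map_add]
    constructor
    · rintro rfl; abel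
    · intro hy
      rw [sub_eq_iff_eq_add] at hy ⊢
      exact hy.trans (by abel)
  rw [key]
  constructor
  · intro hy
    rw [← hy, ← mat_mul, Matrix.nonsing_inv_mul _ hE, mat_one]
  · intro hy
    rw [hy, ← mat_mul, Matrix.mul_nonsing_inv _ hE, mat_one]

variable {Ap : Matrix σ σ ℝ} {Bp : Matrix σ κ ℝ} {Cp : Matrix ι σ ℝ} {Dp : Matrix ι κ ℝ}
  {A : Matrix τ τ ℝ} {B : Matrix τ ι ℝ} {C : Matrix κ τ ℝ} {D : Matrix κ ι ℝ}

lemma loopMap_discSys_iff (hE : IsUnit (1 - Dp * D).det) (y r : ℕ → EuclideanSpace ℝ ι) :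
    loopMap (discSys Ap Bp Cp Dp) (discSys A B C D) y = r ↔ ∀ k,
      y k = mat (1 - Dp * D)⁻¹ (mat Cp (discState Ap Bp (discSys A B C D y) k)
        + mat Dp (mat C (discState A B y k)) + r k) := by
  rw [funext_iff]
  refine forall_congr' fun k => ?_
  rw [← algebraic_loop_iff hE]
  rfl

/-- States at time k depend only on the values of y before k, and the algebraic loop then determines
y k. Induction on k gives uniqueness, and running the recursion gives existence. -/
lemma bijective_loopMap_discSys (hE : IsUnit (1 - Dp * D).det) :
    Function.Bijective (loopMap (discSys Ap Bp Cp Dp) (discSys A B C D)) := by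
  constructor
  · intro y y' hyy
    have hy := (loopMap_discSys_iff hE y _).1 hyy
    have hy' := (loopMap_discSys_iff (Ap := Ap) (Bp := Bp) (Cp := Cp) (A := A) (B := B) (C := C)
      hE y' _).1 rfl
    have key : ∀ k, discState A B y k = discState A B y' k ∧
        discState Ap Bp (discSys A B C D y) k = discState Ap Bp (discSys A B C D y') k := by
      intro k
      induction k with
      | zero => exact ⟨rfl, rfl⟩
      | succ k ih =>
        have hk : y k = y' k := by rw [hy, hy', ih.1, ih.2]
        simp only [discState_succ, discSys_apply, ih.1, ih.2, hk, and_self]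
    funext k
    rw [hy, hy', (key k).1, (key k).2]
  · intro r
    -- `out` is the value that the algebraic loop forces from given states; `st` runs both states
    -- with this value fed back.
    let out : EuclideanSpace ℝ σ × EuclideanSpace ℝ τ → ℕ → EuclideanSpace ℝ ι := fun s k =>
      mat (1 - Dp * D)⁻¹ (mat Cp s.1 + mat Dp (mat C s.2) + r k)
    let st : ℕ → EuclideanSpace ℝ σ × EuclideanSpace ℝ τ := fun k =>
      Nat.rec (0, 0) (fun k s => (mat Ap s.1 + mat Bp (mat C s.2 + mat D (out s k)),
        mat A s.2 + mat B (out s k))) k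
    have hst : ∀ k, discState Ap Bp (discSys A B C D fun k => out (st k) k) k = (st k).1 ∧
        discState A B (fun k => out (st k) k) k = (st k).2 := by
      intro k
      induction k with
      | zero => exact ⟨rfl, rfl⟩
      | succ k ih =>
        simp only [discState_succ, discSys_apply, ih.1, ih.2]
        exact ⟨rfl, rfl⟩
    refine ⟨fun k => out (st k) k, (loopMap_discSys_iff hE _ _).2 fun k => ?_⟩
    rw [(hst k).1, (hst k).2]

end DiscreteLoop

/-! ### From continuous-time loops to lifted sequences -/

section Sampling

variable {n nw nu nz ny nk : ℕ} (G : Plant n nw nu nz ny)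

lemma evol_hold_period (A : Matrix (Fin n) (Fin n) ℝ) (B : Matrix (Fin n) (Fin nu) ℝ) {h : ℝ}
    (hh : 0 < h) {M : ℕ} (hM : 0 < M) (q : ℕ → EuclideanSpace ℝ (Fin M × Fin nu)) (k : ℕ)
    {s : ℝ} (hs : 0 ≤ s) (hsh : s ≤ h) :
    evol A (fun τ => mat B (hold (h / M) (unlift M q) (k * h + τ))) s =
      evol A (fun τ => mat B (cell h M (q k) τ)) s := by
  refine evol_congr hs fun τ h0 h1 => ?_
  rw [hold_unlift_period hh hM q k h0 (h1.trans_le hsh)]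

/-- The plant state at the times kh follows the discrete recursion, by restarting the evolution at
each period; the samples inside a period are then read off from that state and the held input. -/
lemma discLift_G₂₂ {h : ℝ} (hh : 0 < h) {M₁ M₂ : ℕ} (hM₁ : 0 < M₁) (hM₂ : 0 < M₂) :
    discLift h M₁ M₂ G.G₂₂ = discSys (G.Ah h) (G.Bh h M₂) (G.Ch h M₁) (G.Dh h M₁ M₂) := by
  funext q
  set u := hold (h / M₂) (unlift M₂ q) with hu
  have hu_int : LocInt u := locInt_hold (by positivity) _
  set x := evol G.A (fun τ => mat G.B₂ (u τ)) with hx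
  have hstep : ∀ (k : ℕ) s, 0 ≤ s → s ≤ h → x (k * h + s) = flow G.A s (x (k * h)) +
      evol G.A (fun τ => mat G.B₂ (cell h M₂ (q k) τ)) s := by
    intro k s hs hsh
    rw [hx, evol_shift (hu_int.clm _) (by positivity) hs,
      evol_hold_period G.A G.B₂ hh hM₂ q k hs hsh]
  have hstate : ∀ k : ℕ, x (k * h) = discState (G.Ah h) (G.Bh h M₂) q k := by
    intro k
    induction k with
    | zero => simp [hx, evol_zero, discState]
    | succ k ih =>
      have : ((k + 1 : ℕ) : ℝ) * h = k * h + h := by push_cast; ring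
      rw [this, hstep k h hh.le le_rfl, discState_succ, ih, mat_Bh G hh hM₂]
      rfl
  funext k
  rw [discLift, lift_sampler hM₁, discSys_apply, mat_Ch, mat_Dh G hh hM₂, ← stack_add]
  congr 1; funext i
  have hi := slot_time_nonneg hh i
  rw [Plant.G₂₂, contSys_eq _ _ _ _ hu_int (by positivity), mat_zero, add_zero, ← map_add,
    ← hstate, ← hstep k _ hi (slot_time_lt hh i).le]

variable {G} in
-- Sampling and lifting intertwine the two loop maps, which lets solvability and solutions pass
-- between them.
lemma lift_sampler_loopMap {h : ℝ} {M₁ M₂ : ℕ} (hM₁ : 0 < M₁) (hM₂ : 0 < M₂)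
    (K : (ℕ → EuclideanSpace ℝ (Fin ny)) → (ℕ → EuclideanSpace ℝ (Fin nu)))
    (y : ℝ → EuclideanSpace ℝ (Fin ny)) :
    lift M₁ (sampler (h / M₁) (loopMap G.G₂₂ (Plant.heldController h M₁ M₂ K) y)) =
      loopMap (discLift h M₁ M₂ G.G₂₂) (liftedController M₁ M₂ K)
        (lift M₁ (sampler (h / M₁) y)) := by
  simp only [loopMap, discLift, liftedController, unlift_lift hM₁, unlift_lift hM₂]
  rfl

lemma heldController_eq {h : ℝ} {M₁ M₂ : ℕ} (hM₁ : 0 < M₁) (hM₂ : 0 < M₂)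
    (K : (ℕ → EuclideanSpace ℝ (Fin ny)) → (ℕ → EuclideanSpace ℝ (Fin nu)))
    (y : ℝ → EuclideanSpace ℝ (Fin ny)) :
    Plant.heldController h M₁ M₂ K y = hold (h / M₂) (unlift M₂ (liftedController M₁ M₂ K
      (lift M₁ (sampler (h / M₁) y)))) := by
  simp only [Plant.heldController, liftedController, unlift_lift hM₁, unlift_lift hM₂]

variable {G} in
-- The feedback term depends on y only through its samples. Equal loop values thus force equal
-- samples, hence equal feedback and equal y.
lemma bijective_loopMap_of_lifted {h : ℝ} {M₁ M₂ : ℕ} (hM₁ : 0 < M₁) (hM₂ : 0 < M₂)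
    (K : (ℕ → EuclideanSpace ℝ (Fin ny)) → (ℕ → EuclideanSpace ℝ (Fin nu)))
    (hbij : Function.Bijective (loopMap (discLift h M₁ M₂ G.G₂₂) (liftedController M₁ M₂ K))) :
    Function.Bijective (loopMap G.G₂₂ (Plant.heldController h M₁ M₂ K)) := by
  constructor
  · intro y y' hyy
    have h1 : lift M₁ (sampler (h / M₁) y) = lift M₁ (sampler (h / M₁) y') := by
      apply hbij.1
      rw [← lift_sampler_loopMap hM₁ hM₂, ← lift_sampler_loopMap hM₁ hM₂, hyy]
    simp only [loopMap, heldController_eq hM₁ hM₂, h1] at hyy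
    exact sub_left_injective hyy
  · intro r
    obtain ⟨yd, hyd⟩ := hbij.2 (lift M₁ (sampler (h / M₁) r))
    -- Once the samples `yd` are found, y must be `r` plus the plant response to the control
    -- computed from them; its samples are again `yd`.
    refine ⟨r + G.G₂₂ (hold (h / M₂) (unlift M₂ (liftedController M₁ M₂ K yd))), ?_⟩
    have h1 : lift M₁ (sampler (h / M₁) (r + G.G₂₂ (hold (h / M₂) (unlift M₂
        (liftedController M₁ M₂ K yd))))) = yd := by
      rw [loopMap, sub_eq_iff_eq_add] at hyd
      exact hyd.symm
    rw [loopMap, heldController_eq hM₁ hM₂, h1, add_sub_cancel_right]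

/-- The lifted measurement sequence `y_d` of the closed loop with exogenous input `w`. -/
def Plant.loopOut (h : ℝ) (M₁ M₂ : ℕ)
    (K : Controller (Fin nk) (Fin M₁ × Fin ny) (Fin M₂ × Fin nu))
    (w : ℝ → EuclideanSpace ℝ (Fin nw)) : ℕ → EuclideanSpace ℝ (Fin M₁ × Fin ny) :=
  Function.invFun (loopMap (discLift h M₁ M₂ G.G₂₂) (discSys K.A K.B K.C K.D))
    (lift M₁ (sampler (h / M₁) (G.G₂₁ w)))

/-- The lifted control sequence `u_d` of the closed loop with exogenous input `w`. -/
def Plant.loopIn (h : ℝ) (M₁ M₂ : ℕ)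
    (K : Controller (Fin nk) (Fin M₁ × Fin ny) (Fin M₂ × Fin nu))
    (w : ℝ → EuclideanSpace ℝ (Fin nw)) : ℕ → EuclideanSpace ℝ (Fin M₂ × Fin nu) :=
  discSys K.A K.B K.C K.D (G.loopOut h M₁ M₂ K w)

variable {G} in
-- Sampling the solution of the continuous-time loop equation solves the lifted equation, so by
-- uniqueness the control is the one computed from the lifted loop.
lemma multirate_eq {h : ℝ} {M₁ M₂ : ℕ} (hM₁ : 0 < M₁) (hM₂ : 0 < M₂)
    {K : (ℕ → EuclideanSpace ℝ (Fin ny)) → (ℕ → EuclideanSpace ℝ (Fin nu))}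
    {Kd : Controller (Fin nk) (Fin M₁ × Fin ny) (Fin M₂ × Fin nu)}
    (hKd : liftedController M₁ M₂ K = discSys Kd.A Kd.B Kd.C Kd.D)
    (hbij : Function.Bijective (loopMap (discLift h M₁ M₂ G.G₂₂) (discSys Kd.A Kd.B Kd.C Kd.D)))
    (w : ℝ → EuclideanSpace ℝ (Fin nw)) :
    G.multirate h M₁ M₂ K w =
      G.G₁₁ w + G.G₁₂ (hold (h / M₂) (unlift M₂ (G.loopIn h M₁ M₂ Kd w))) := by
  rw [Plant.multirate, lft, heldController_eq hM₁ hM₂, hKd]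
  congr 5
  have hb := bijective_loopMap_of_lifted hM₁ hM₂ K (hKd ▸ hbij)
  have h1 := congrArg (fun y => lift M₁ (sampler (h / M₁) y))
    (Function.invFun_eq (hb.2 (G.G₂₁ w)))
  rw [lift_sampler_loopMap hM₁ hM₂, hKd] at h1
  rw [Plant.loopOut, ← h1, Function.leftInverse_invFun hbij.1]

variable {G} in
-- The discretized loop has the same feedback equation as the sampled-data loop driven by the held
-- input, so the approximation is exact inside the loop: only the input is held and only the output
-- is sampled.
lemma fsfh_eq {h : ℝ} {M₁ M₂ : ℕ} (hM₁ : 0 < M₁) (hM₂ : 0 < M₂)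
    {K : (ℕ → EuclideanSpace ℝ (Fin ny)) → (ℕ → EuclideanSpace ℝ (Fin nu))}
    {Kd : Controller (Fin nk) (Fin M₁ × Fin ny) (Fin M₂ × Fin nu)}
    (hKd : liftedController M₁ M₂ K = discSys Kd.A Kd.B Kd.C Kd.D)
    (hbij : Function.Bijective (loopMap (discLift h M₁ M₂ G.G₂₂) (discSys Kd.A Kd.B Kd.C Kd.D)))
    (N : ℕ) (v : ℕ → EuclideanSpace ℝ (Fin N × Fin nw)) :
    G.fsfh h M₁ M₂ K N v =
      lift N (sampler (h / N) (G.multirate h M₁ M₂ K (hold (h / N) (unlift N v)))) := by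
  rw [multirate_eq hM₁ hM₂ hKd hbij, Plant.fsfh, lft, hKd]
  rfl

end Sampling

/-! ### Closed-loop trajectories and the realization of T_dN -/

section

section Blocks

variable {σ τ ι κ : Type*} [Fintype σ] [DecidableEq σ] [Fintype τ] [DecidableEq τ]
  [Fintype ι] [DecidableEq ι]

lemma mat_fromCols [Fintype κ] (P : Matrix κ σ ℝ) (Q : Matrix κ τ ℝ) (x : EuclideanSpace ℝ σ)
    (ξ : EuclideanSpace ℝ τ) : mat (Matrix.fromCols P Q) (pair x ξ) = mat P x + mat Q ξ := by
  ext i; simp [mat_coord, pair]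

lemma mat_fromRows {σ τ : Type*} [Fintype σ] [Fintype τ] (P : Matrix σ ι ℝ)
    (Q : Matrix τ ι ℝ) (v : EuclideanSpace ℝ ι) :
    mat (Matrix.fromRows P Q) v = pair (mat P v) (mat Q v) := by
  ext (i | i) <;> simp [mat_coord, pair]

lemma mat_stack {M p : ℕ} (F : Fin M → Matrix (Fin p) ι ℝ) (v : EuclideanSpace ℝ ι) :
    mat (Matrix.of fun (r : Fin M × Fin p) a => F r.1 r.2 a) v = stack fun i => mat (F i) v := by
  ext r; rfl

lemma exists_mat_evol_cell {n m : ℕ} (A : Matrix (Fin n) (Fin n) ℝ)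
    (B : Matrix (Fin n) (Fin m) ℝ) {h : ℝ} (hh : 0 < h) {N : ℕ} (hN : 0 < N) {s : ℝ} (hs : 0 ≤ s) :
    ∃ R : Matrix (Fin n) (Fin N × Fin m) ℝ, ∀ q,
      evol A (fun τ => mat B (cell h N q τ)) s = mat R q := by
  obtain ⟨R, hR⟩ := exists_mat (ι := Fin N × Fin m) (κ := Fin n)
    { toFun := fun q => evol A (fun τ => mat B (cell h N q τ)) s
      map_add' := fun q q' => by
        simp only [cell_add, map_add]
        exact evol_add_fun ((locInt_cell hh hN q).clm _) ((locInt_cell hh hN q').clm _) hs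
      map_smul' := fun c q => by
        simp only [cell_smul, map_smul]
        exact evol_const_smul c s }
  exact ⟨R, fun q => (hR q).symm⟩

lemma exists_mat_cell (m : ℕ) (h : ℝ) (N : ℕ) (s : ℝ) :
    ∃ L : Matrix (Fin m) (Fin N × Fin m) ℝ, ∀ q, cell h N q s = mat L q := by
  obtain ⟨R, hR⟩ := exists_mat (ι := Fin N × Fin m) (κ := Fin m)
    { toFun := fun q => cell h N q s
      map_add' := fun q q' => cell_add h N q q' s
      map_smul' := fun c q => cell_smul h N c q s }
  exact ⟨R, fun q => (hR q).symm⟩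

end Blocks

variable {n nw nu nz ny nk : ℕ} (G : Plant n nw nu nz ny) (h : ℝ) (M₁ M₂ : ℕ)
  (Kd : Controller (Fin nk) (Fin M₁ × Fin ny) (Fin M₂ × Fin nu))

/-- The plant state of the closed loop. -/
def Plant.plantState (w : ℝ → EuclideanSpace ℝ (Fin nw)) : ℝ → EuclideanSpace ℝ (Fin n) :=
  evol G.A fun τ => mat G.B₁ (w τ) + mat G.B₂ (hold (h / M₂) (unlift M₂ (G.loopIn h M₁ M₂ Kd w)) τ)

/-- The joint state of plant and controller at the beginning of the periods. -/
def Plant.loopState (w : ℝ → EuclideanSpace ℝ (Fin nw)) (k : ℕ) :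
    EuclideanSpace ℝ (Fin n ⊕ Fin nk) :=
  pair (G.plantState h M₁ M₂ Kd w (k * h)) (discState Kd.A Kd.B (G.loopOut h M₁ M₂ Kd w) k)

/-- The contribution of `w` on the `k`-th period to the plant state `s` units of time later. -/
def Plant.kick (w : ℝ → EuclideanSpace ℝ (Fin nw)) (k : ℕ) (s : ℝ) : EuclideanSpace ℝ (Fin n) :=
  evol G.A (fun τ => mat G.B₁ (w (k * h + τ))) s

/-- The contribution of `w` on the `k`-th period to the samples of `y` in that period. -/
def Plant.kickOut (w : ℝ → EuclideanSpace ℝ (Fin nw)) (k : ℕ) :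
    EuclideanSpace ℝ (Fin M₁ × Fin ny) :=
  stack fun i => mat G.C₂ (G.kick h w k (i * (h / M₁)))

/-- `(I - Dh D_K)⁻¹`. -/
def Plant.loopInv : Matrix (Fin M₁ × Fin ny) (Fin M₁ × Fin ny) ℝ := (1 - G.Dh h M₁ M₂ * Kd.D)⁻¹

/-- How the joint state determines the lifted control. -/
def Plant.inputGain : Matrix (Fin M₂ × Fin nu) (Fin n ⊕ Fin nk) ℝ :=
  Matrix.fromCols (Kd.D * G.loopInv h M₁ M₂ Kd * G.Ch h M₁)
    (Kd.C + Kd.D * G.loopInv h M₁ M₂ Kd * G.Dh h M₁ M₂ * Kd.C)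

variable {G h M₁ M₂ Kd} {w w' : ℝ → EuclideanSpace ℝ (Fin nw)}

/-- The standing assumptions on the closed loop, apart from stability. -/
structure Plant.IsLoop (G : Plant n nw nu nz ny) (h : ℝ) (M₁ M₂ : ℕ)
    (Kd : Controller (Fin nk) (Fin M₁ × Fin ny) (Fin M₂ × Fin nu)) : Prop where
  period_pos : 0 < h
  inputs_pos : 0 < M₁
  outputs_pos : 0 < M₂
  wellPosed : G.WellPosed h M₁ M₂ Kd

namespace Plant.IsLoop

lemma bijective (H : G.IsLoop h M₁ M₂ Kd) :
    Function.Bijective (loopMap (discLift h M₁ M₂ G.G₂₂) (discSys Kd.A Kd.B Kd.C Kd.D)) := by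
  rw [discLift_G₂₂ G H.period_pos H.inputs_pos H.outputs_pos]
  exact bijective_loopMap_discSys H.wellPosed

lemma locInt_control (H : G.IsLoop h M₁ M₂ Kd) (w : ℝ → EuclideanSpace ℝ (Fin nw)) :
    LocInt (hold (h / M₂) (unlift M₂ (G.loopIn h M₁ M₂ Kd w))) := by
  have := H.period_pos
  have := H.outputs_pos
  exact locInt_hold (by positivity) _

lemma locInt_forcing (H : G.IsLoop h M₁ M₂ Kd) (hw : LocInt w) :
    LocInt fun τ => mat G.B₁ (w τ) +
      mat G.B₂ (hold (h / M₂) (unlift M₂ (G.loopIn h M₁ M₂ Kd w)) τ) :=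
  (hw.clm _).add ((H.locInt_control w).clm _)

lemma plantState_eq_add (H : G.IsLoop h M₁ M₂ Kd) (hw : LocInt w) {t : ℝ} (ht : 0 ≤ t) :
    G.plantState h M₁ M₂ Kd w t = evol G.A (fun τ => mat G.B₁ (w τ)) t +
      evol G.A (fun τ => mat G.B₂ (hold (h / M₂) (unlift M₂ (G.loopIn h M₁ M₂ Kd w)) τ)) t :=
  evol_add_fun (hw.clm _) ((H.locInt_control w).clm _) ht

lemma plantState_period (H : G.IsLoop h M₁ M₂ Kd) (hw : LocInt w) (k : ℕ) {s : ℝ} (hs : 0 ≤ s)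
    (hsh : s ≤ h) :
    G.plantState h M₁ M₂ Kd w (k * h + s) = flow G.A s (G.plantState h M₁ M₂ Kd w (k * h)) +
      evol G.A (fun τ => mat G.B₂ (cell h M₂ (G.loopIn h M₁ M₂ Kd w k) τ)) s +
      G.kick h w k s := by
  have hk : 0 ≤ (k : ℝ) * h := mul_nonneg k.cast_nonneg H.period_pos.le
  rw [plantState, evol_shift (H.locInt_forcing hw) hk hs,
    evol_add_fun ((hw.shift hk).clm _) (((H.locInt_control w).shift hk).clm _) hs,
    evol_hold_period G.A G.B₂ H.period_pos H.outputs_pos _ k hs hsh, add_assoc]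
  congr 1
  exact add_comm _ _

lemma loopMap_loopOut (H : G.IsLoop h M₁ M₂ Kd) (w : ℝ → EuclideanSpace ℝ (Fin nw)) :
    loopMap (discLift h M₁ M₂ G.G₂₂) (discSys Kd.A Kd.B Kd.C Kd.D) (G.loopOut h M₁ M₂ Kd w) =
      lift M₁ (sampler (h / M₁) (G.G₂₁ w)) :=
  Function.invFun_eq (H.bijective.2 _)

/-- Neither `G₂₁` nor `G₂₂` has a direct feedthrough, so the measurements are `C₂` applied to the
full plant state. -/
lemma loopOut_eq_stack (H : G.IsLoop h M₁ M₂ Kd) (hw : LocInt w) (k : ℕ) :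
    G.loopOut h M₁ M₂ Kd w k =
      stack fun i : Fin M₁ => mat G.C₂ (G.plantState h M₁ M₂ Kd w (k * h + i * (h / M₁))) := by
  have hh := H.period_pos
  have h1 := congrFun (H.loopMap_loopOut w) k
  simp only [loopMap, Pi.sub_apply] at h1
  rw [sub_eq_iff_eq_add, discLift, lift_sampler H.inputs_pos, lift_sampler H.inputs_pos,
    ← stack_add] at h1
  rw [h1]
  congr 1; funext i
  have hi := slot_time_nonneg hh i
  have ht : 0 ≤ (k : ℝ) * h + i * (h / M₁) := by positivity
  rw [show discSys Kd.A Kd.B Kd.C Kd.D (G.loopOut h M₁ M₂ Kd w) = G.loopIn h M₁ M₂ Kd w from rfl,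
    G₂₁, G₂₂, contSys_eq _ _ _ _ hw ht, contSys_eq _ _ _ _ (H.locInt_control w) ht,
    mat_zero, mat_zero, add_zero, add_zero, ← map_add, H.plantState_eq_add hw ht]

lemma loopIn_apply (w : ℝ → EuclideanSpace ℝ (Fin nw)) (k : ℕ) :
    G.loopIn h M₁ M₂ Kd w k = mat Kd.C (discState Kd.A Kd.B (G.loopOut h M₁ M₂ Kd w) k) +
      mat Kd.D (G.loopOut h M₁ M₂ Kd w k) := rfl

lemma loopOut_eq (H : G.IsLoop h M₁ M₂ Kd) (hw : LocInt w) (k : ℕ) :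
    G.loopOut h M₁ M₂ Kd w k = mat (G.loopInv h M₁ M₂ Kd)
      (mat (G.Ch h M₁) (G.plantState h M₁ M₂ Kd w (k * h)) +
        mat (G.Dh h M₁ M₂) (mat Kd.C (discState Kd.A Kd.B (G.loopOut h M₁ M₂ Kd w) k)) +
        G.kickOut h M₁ w k) := by
  refine (algebraic_loop_iff H.wellPosed _ _ _ _).1 ?_
  rw [sub_eq_iff_eq_add, ← loopIn_apply, mat_Ch, mat_Dh G H.period_pos H.outputs_pos, kickOut,
    ← stack_add, ← stack_add, H.loopOut_eq_stack hw]
  congr 1; funext i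
  rw [H.plantState_period hw k (slot_time_nonneg H.period_pos i)
    (slot_time_lt H.period_pos i).le, map_add, map_add, add_comm]

lemma loopIn_eq (H : G.IsLoop h M₁ M₂ Kd) (hw : LocInt w) (k : ℕ) :
    G.loopIn h M₁ M₂ Kd w k = mat (G.inputGain h M₁ M₂ Kd) (G.loopState h M₁ M₂ Kd w k) +
      mat (Kd.D * G.loopInv h M₁ M₂ Kd) (G.kickOut h M₁ w k) := by
  rw [loopIn_apply, H.loopOut_eq hw, inputGain, loopState, mat_fromCols]
  simp only [mat_add, mat_mul, map_add]
  abel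

lemma loopState_zero (w : ℝ → EuclideanSpace ℝ (Fin nw)) :
    G.loopState h M₁ M₂ Kd w 0 = 0 := by
  have : G.plantState h M₁ M₂ Kd w (((0 : ℕ) : ℝ) * h) = 0 := by simp [plantState, evol_zero]
  rw [loopState, this]
  ext (i | i) <;> simp [pair, discState]

/-- Eliminating `y_d` through the algebraic loop leaves `closedLoop` acting on the state; `w` enters
only through its effect within the current period. -/
lemma loopState_succ (H : G.IsLoop h M₁ M₂ Kd) (hw : LocInt w) (k : ℕ) :
    G.loopState h M₁ M₂ Kd w (k + 1) =
      mat (G.closedLoop h M₁ M₂ Kd) (G.loopState h M₁ M₂ Kd w k) +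
      pair (G.kick h w k h + mat (G.Bh h M₂ * Kd.D * G.loopInv h M₁ M₂ Kd) (G.kickOut h M₁ w k))
        (mat (Kd.B * G.loopInv h M₁ M₂ Kd) (G.kickOut h M₁ w k)) := by
  have hk : ((k + 1 : ℕ) : ℝ) * h = k * h + h := by push_cast; ring
  have hcl : G.closedLoop h M₁ M₂ Kd = Matrix.fromBlocks
      (G.Ah h + G.Bh h M₂ * Kd.D * G.loopInv h M₁ M₂ Kd * G.Ch h M₁)
      (G.Bh h M₂ * (Kd.C + Kd.D * G.loopInv h M₁ M₂ Kd * G.Dh h M₁ M₂ * Kd.C))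
      (Kd.B * G.loopInv h M₁ M₂ Kd * G.Ch h M₁)
      (Kd.A + Kd.B * G.loopInv h M₁ M₂ Kd * G.Dh h M₁ M₂ * Kd.C) := rfl
  rw [loopState, hk, H.plantState_period hw k H.period_pos.le le_rfl, discState_succ,
    ← mat_Bh G H.period_pos H.outputs_pos, loopIn_apply, loopState, hcl, mat_fromBlocks,
    ← pair_add]
  rw [show flow G.A h = mat (G.Ah h) from rfl]
  rw [H.loopOut_eq hw k]
  simp only [mat_add, mat_mul, map_add]
  congr 1 <;> abel

lemma multirate_apply (H : G.IsLoop h M₁ M₂ Kd)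
    {K : (ℕ → EuclideanSpace ℝ (Fin ny)) → (ℕ → EuclideanSpace ℝ (Fin nu))}
    (hKd : liftedController M₁ M₂ K = discSys Kd.A Kd.B Kd.C Kd.D) (hw : LocInt w)
    {t : ℝ} (ht : 0 ≤ t) :
    G.multirate h M₁ M₂ K w t = mat G.C₁ (G.plantState h M₁ M₂ Kd w t) + mat G.D₁₁ (w t) +
      mat G.D₁₂ (hold (h / M₂) (unlift M₂ (G.loopIn h M₁ M₂ Kd w)) t) := by
  rw [multirate_eq H.inputs_pos H.outputs_pos hKd H.bijective, Pi.add_apply, G₁₁, G₁₂,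
    contSys_eq _ _ _ _ hw ht, contSys_eq _ _ _ _ (H.locInt_control w) ht,
    H.plantState_eq_add hw ht, map_add]
  abel

/-- The sum of two solutions solves the loop equation with the summed input, and the solution is
unique. Local integrability makes the input response additive. -/
lemma loopOut_add (H : G.IsLoop h M₁ M₂ Kd) (hw : LocInt w) (hw' : LocInt w') :
    G.loopOut h M₁ M₂ Kd (w + w') = G.loopOut h M₁ M₂ Kd w + G.loopOut h M₁ M₂ Kd w' := by
  have hh := H.period_pos
  apply H.bijective.1
  have h1 : loopMap (discLift h M₁ M₂ G.G₂₂) (discSys Kd.A Kd.B Kd.C Kd.D)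
      (G.loopOut h M₁ M₂ Kd w + G.loopOut h M₁ M₂ Kd w') =
      loopMap (discLift h M₁ M₂ G.G₂₂) (discSys Kd.A Kd.B Kd.C Kd.D) (G.loopOut h M₁ M₂ Kd w) +
      loopMap (discLift h M₁ M₂ G.G₂₂) (discSys Kd.A Kd.B Kd.C Kd.D)
        (G.loopOut h M₁ M₂ Kd w') := by
    rw [discLift_G₂₂ G H.period_pos H.inputs_pos H.outputs_pos]
    simp only [loopMap, discSys_add]
    abel
  rw [h1, H.loopMap_loopOut, H.loopMap_loopOut, H.loopMap_loopOut, ← lift_add]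
  congr 1; funext k
  simp only [sampler, Pi.add_apply]
  have ht : 0 ≤ (k : ℝ) * (h / M₁) := by positivity
  rw [G₂₁, contSys_eq _ _ _ _ (hw.add hw') ht, contSys_eq _ _ _ _ hw ht,
    contSys_eq _ _ _ _ hw' ht]
  simp only [mat_zero, add_zero, Pi.add_apply]
  rw [← map_add, ← evol_add_fun (hw.clm _) (hw'.clm _) ht]
  simp only [map_add]

lemma multirate_add (H : G.IsLoop h M₁ M₂ Kd)
    {K : (ℕ → EuclideanSpace ℝ (Fin ny)) → (ℕ → EuclideanSpace ℝ (Fin nu))}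
    (hKd : liftedController M₁ M₂ K = discSys Kd.A Kd.B Kd.C Kd.D) (hw : LocInt w)
    (hw' : LocInt w') {t : ℝ} (ht : 0 ≤ t) :
    G.multirate h M₁ M₂ K (w + w') t = G.multirate h M₁ M₂ K w t + G.multirate h M₁ M₂ K w' t := by
  have hin : G.loopIn h M₁ M₂ Kd (w + w') = G.loopIn h M₁ M₂ Kd w + G.loopIn h M₁ M₂ Kd w' := by
    rw [loopIn, H.loopOut_add hw hw', discSys_add]; rfl
  have hhold : ∀ τ, hold (h / M₂) (unlift M₂ (G.loopIn h M₁ M₂ Kd (w + w'))) τ =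
      hold (h / M₂) (unlift M₂ (G.loopIn h M₁ M₂ Kd w)) τ +
      hold (h / M₂) (unlift M₂ (G.loopIn h M₁ M₂ Kd w')) τ := by
    intro τ; rw [hin, unlift_add]; rfl
  rw [H.multirate_apply hKd (hw.add hw') ht, H.multirate_apply hKd hw ht,
    H.multirate_apply hKd hw' ht, hhold]
  have hx : G.plantState h M₁ M₂ Kd (w + w') t =
      G.plantState h M₁ M₂ Kd w t + G.plantState h M₁ M₂ Kd w' t := by
    rw [plantState, plantState, plantState,
      ← evol_add_fun (H.locInt_forcing hw) (H.locInt_forcing hw') ht]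
    congr 1; funext τ
    rw [hhold, Pi.add_apply, map_add, map_add]
    abel
  rw [hx, Pi.add_apply]
  simp only [map_add]
  abel

lemma kick_hold (H : G.IsLoop h M₁ M₂ Kd) {N : ℕ} (hN : 0 < N)
    (v : ℕ → EuclideanSpace ℝ (Fin N × Fin nw)) (k : ℕ) {s : ℝ} (hs : 0 ≤ s) (hsh : s ≤ h) :
    G.kick h (hold (h / N) (unlift N v)) k s =
      evol G.A (fun τ => mat G.B₁ (cell h N (v k) τ)) s :=
  evol_hold_period G.A G.B₁ H.period_pos hN v k hs hsh

/-- A held input acts linearly on each period through the finite vector `v k`, so all its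
contributions are matrices that do not depend on k, while the homogeneous part of the recursion does
not involve N. -/
lemma exists_realization (H : G.IsLoop h M₁ M₂ Kd)
    {K : (ℕ → EuclideanSpace ℝ (Fin ny)) → (ℕ → EuclideanSpace ℝ (Fin nu))}
    (hKd : liftedController M₁ M₂ K = discSys Kd.A Kd.B Kd.C Kd.D) {N : ℕ} (hN : 0 < N) :
    ∃ (B : Matrix (Fin n ⊕ Fin nk) (Fin N × Fin nw) ℝ)
      (C : Matrix (Fin N × Fin nz) (Fin n ⊕ Fin nk) ℝ)
      (D : Matrix (Fin N × Fin nz) (Fin N × Fin nw) ℝ),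
      G.fsfh h M₁ M₂ K N = discSys (G.closedLoop h M₁ M₂ Kd) B C D := by
  have hh := H.period_pos
  have hN0 : (0 : ℝ) < N := by exact_mod_cast hN
  obtain ⟨R, hR⟩ := exists_mat_evol_cell G.A G.B₁ hh hN hh.le
  choose P hP using fun i : Fin M₁ =>
    exists_mat_evol_cell G.A G.B₁ hh hN (slot_time_nonneg hh i)
  choose Q hQ using fun i : Fin N =>
    exists_mat_evol_cell G.A G.B₁ hh hN (slot_time_nonneg hh i)
  choose S hS using fun i : Fin N =>
    exists_mat_evol_cell G.A G.B₂ hh H.outputs_pos (slot_time_nonneg hh i)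
  choose L hL using fun i : Fin N => exists_mat_cell nw h N (i * (h / N))
  choose L' hL' using fun i : Fin N => exists_mat_cell nu h M₂ (i * (h / N))
  -- `X` reads the plant state off the joint state and `Y` gives the part of the measurements forced
  -- by `v k`; the control in period k is `U` of the joint state plus `V` of `v k`.
  let X : Matrix (Fin n) (Fin n ⊕ Fin nk) ℝ := Matrix.fromCols 1 0
  let Y : Matrix (Fin M₁ × Fin ny) (Fin N × Fin nw) ℝ :=
    Matrix.of fun r a => (G.C₂ * P r.1) r.2 a
  let U := G.inputGain h M₁ M₂ Kd
  let V := Kd.D * G.loopInv h M₁ M₂ Kd * Y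
  let B := Matrix.fromRows (R + G.Bh h M₂ * Kd.D * G.loopInv h M₁ M₂ Kd * Y)
    (Kd.B * G.loopInv h M₁ M₂ Kd * Y)
  let Ci : Fin N → Matrix (Fin nz) (Fin n ⊕ Fin nk) ℝ := fun i =>
    G.C₁ * (NormedSpace.exp (((i : ℝ) * (h / N)) • G.A) * X + S i * U) + G.D₁₂ * (L' i * U)
  let Di : Fin N → Matrix (Fin nz) (Fin N × Fin nw) ℝ := fun i =>
    G.C₁ * (S i * V + Q i) + G.D₁₁ * L i + G.D₁₂ * (L' i * V)
  refine ⟨B, Matrix.of fun r a => Ci r.1 r.2 a, Matrix.of fun r a => Di r.1 r.2 a, ?_⟩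
  funext v
  set w := hold (h / N) (unlift N v) with hwdef
  have hw : LocInt w := locInt_hold (by positivity) _
  have hY : ∀ k, G.kickOut h M₁ w k = mat Y (v k) := by
    intro k
    rw [kickOut, mat_stack (fun i => G.C₂ * P i)]
    congr 1; funext i
    rw [H.kick_hold hN v k (slot_time_nonneg hh i) (slot_time_lt hh i).le, hP, mat_mul]
  have hstate : ∀ k, G.loopState h M₁ M₂ Kd w k = discState (G.closedLoop h M₁ M₂ Kd) B v k := by
    intro k
    induction k with
    | zero => exact loopState_zero w
    | succ k ih =>
      rw [H.loopState_succ hw, discState_succ, ih, hY, H.kick_hold hN v k hh.le le_rfl, hR,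
        mat_fromRows, mat_add, mat_mul _ Y, mat_mul _ Y]
  funext k
  rw [fsfh_eq H.inputs_pos H.outputs_pos hKd H.bijective, lift_sampler hN, discSys_apply,
    mat_stack, mat_stack, ← stack_add]
  congr 1; funext i
  have hi := slot_time_nonneg hh i
  have hi' := slot_time_lt hh i
  have hX : G.plantState h M₁ M₂ Kd w (k * h) = mat X (G.loopState h M₁ M₂ Kd w k) := by
    rw [loopState, mat_fromCols, mat_one, mat_zero, add_zero]
  have hU : G.loopIn h M₁ M₂ Kd w k = mat U (G.loopState h M₁ M₂ Kd w k) + mat V (v k) := by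
    rw [H.loopIn_eq hw, hY, mat_mul _ Y]
  rw [← hwdef, H.multirate_apply hKd hw (by positivity), H.plantState_period hw k hi hi'.le,
    hold_unlift_period hh H.outputs_pos _ k hi hi', hL', hwdef,
    hold_unlift_period hh hN _ k hi hi', hL, H.kick_hold hN v k hi hi'.le, hQ, ← hwdef,
    hS, hU, hX, ← hstate]
  simp only [Ci, Di, mat_add, mat_mul, map_add, flow]
  abel

end Plant.IsLoop

end

/-! ### Energies of signals -/

section Energy

variable {E F : Type*} [NormedAddCommGroup E] [NormedAddCommGroup F]

lemma eLpNorm_two_sq {α : Type*} [MeasurableSpace α] (f : α → E) (μ : Measure α) :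
    eLpNorm f 2 μ ^ 2 = ∫⁻ a, ‖f a‖ₑ ^ 2 ∂μ := by
  have := eLpNorm_nnreal_pow_eq_lintegral (f := f) (p := 2) (μ := μ) two_ne_zero
  simpa using this

lemma add_sq_le_two_mul (a b : ℝ≥0∞) : (a + b) ^ 2 ≤ 2 * (a ^ 2 + b ^ 2) := by
  induction a with
  | top => simp
  | coe a =>
    induction b with
    | top => simp
    | coe b =>
      norm_cast
      rw [← NNReal.coe_le_coe]
      push_cast
      nlinarith [sq_nonneg ((a : ℝ) - b)]

lemma enorm_add_sq_le (x y : E) : ‖x + y‖ₑ ^ 2 ≤ 2 * (‖x‖ₑ ^ 2 + ‖y‖ₑ ^ 2) :=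
  (pow_le_pow_left' (enorm_add_le x y) 2).trans (add_sq_le_two_mul _ _)

lemma enorm_sub_sq_le (x y : E) : ‖x - y‖ₑ ^ 2 ≤ 2 * (‖x‖ₑ ^ 2 + ‖y‖ₑ ^ 2) := by
  rw [sub_eq_add_neg, ← enorm_neg y]
  exact enorm_add_sq_le x (-y)

lemma enorm_clm_sq_le [NormedSpace ℝ E] [NormedSpace ℝ F] (L : E →L[ℝ] F) (x : E) :
    ‖L x‖ₑ ^ 2 ≤ (‖L‖₊ ^ 2 : ℝ≥0) * ‖x‖ₑ ^ 2 := by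
  rw [ENNReal.coe_pow, ← enorm_eq_nnnorm, ← mul_pow]
  exact pow_le_pow_left' (L.le_opENorm x) 2

lemma floor_div_eq {δ : ℝ} (hδ : 0 < δ) (k : ℕ) {t : ℝ}
    (ht : t ∈ Set.Ico (k * δ) (k * δ + δ)) : ⌊t / δ⌋₊ = k := by
  rw [Set.mem_Ico, ← add_one_mul, ← le_div_iff₀ hδ, ← div_lt_iff₀ hδ] at ht
  exact (Nat.floor_eq_iff (le_trans (by positivity) ht.1)).2 ht

lemma lintegral_periods {δ : ℝ} (hδ : 0 < δ) (f : ℝ → ℝ≥0∞) :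
    ∫⁻ t in Set.Ici 0, f t = ∑' k : ℕ, ∫⁻ t in Set.Ico (k * δ) (k * δ + δ), f t := by
  have hU : Set.Ici (0 : ℝ) = ⋃ k : ℕ, Set.Ico (k * δ) (k * δ + δ) := by
    ext t
    simp only [Set.mem_Ici, Set.mem_iUnion, Set.mem_Ico]
    constructor
    · intro ht
      refine ⟨⌊t / δ⌋₊, ?_, ?_⟩
      · rw [← le_div_iff₀ hδ]; exact Nat.floor_le (by positivity)
      · rw [← add_one_mul, ← div_lt_iff₀ hδ]; exact Nat.lt_floor_add_one _
    · rintro ⟨k, hk, _⟩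
      exact le_trans (by positivity) hk
  rw [hU, lintegral_iUnion (fun _ => measurableSet_Ico)]
  intro i j hij
  refine Set.disjoint_left.2 fun t hi hj => hij ?_
  rw [← floor_div_eq hδ i hi, ← floor_div_eq hδ j hj]

lemma LocInt.aestronglyMeasurable {f : ℝ → E} (hf : LocInt f) {a b : ℝ} (ha : 0 ≤ a) :
    AEStronglyMeasurable f (volume.restrict (Set.Ico a b)) := by
  rcases le_or_gt a b with hab | hab
  · have := (hf.interval ha (ha.trans hab)).1
    rw [← integrableOn_Icc_iff_integrableOn_Ioc] at this
    exact (this.mono_set Set.Ico_subset_Icc_self).aestronglyMeasurable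
  · rw [Set.Ico_eq_empty (not_lt.2 hab.le)]; simp

/-- Cauchy–Schwarz on an interval; the factor δ is what later makes the forcing negligible between
samples. -/
lemma sq_lintegral_enorm_le {f : ℝ → E} (hf : LocInt f) {a δ : ℝ} (ha : 0 ≤ a) :
    (∫⁻ t in Set.Ico a (a + δ), ‖f t‖ₑ) ^ 2 ≤
      ENNReal.ofReal δ * ∫⁻ t in Set.Ico a (a + δ), ‖f t‖ₑ ^ 2 := by
  have h1 := eLpNorm_le_eLpNorm_mul_rpow_measure_univ (p := 1) (q := 2) one_le_two
    (hf.aestronglyMeasurable ha (b := a + δ))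
  have h2 := pow_le_pow_left' h1 2
  rw [eLpNorm_one_eq_lintegral_enorm, mul_pow, eLpNorm_two_sq] at h2
  refine h2.trans (le_of_eq ?_)
  rw [mul_comm]
  congr 1
  rw [← ENNReal.rpow_natCast, ← ENNReal.rpow_mul]
  simp only [MeasurableSet.univ, Measure.restrict_apply, Set.univ_inter, Real.volume_Ico]
  norm_num

lemma locInt_of_memLp {f : ℝ → E} (hf : MemLp f 2 timeMeasure) : LocInt f := by
  intro t ht
  rw [intervalIntegrable_iff_integrableOn_Ioc_of_le ht]
  have h1 : MemLp f 2 (volume.restrict (Set.Ioc 0 t)) :=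
    hf.mono_measure (Measure.restrict_mono (fun x hx => hx.1.le) le_rfl)
  exact h1.integrable one_le_two

end Energy

/-! ### ℓ²-stability of power stable recursions -/

section Stability

variable {E : Type*} [NormedAddCommGroup E] [NormedSpace ℝ E]

/-- A power stable linear recursion maps `ℓ²` inputs to `ℓ²` states. -/
lemma exists_l2_bound (L : E →L[ℝ] E) (hL : Tendsto (fun k : ℕ => L ^ k) atTop (𝓝 0)) :
    ∃ C : ℝ≥0, ∀ ζ β : ℕ → E, ζ 0 = 0 → (∀ k, ζ (k + 1) = L (ζ k) + β k) →
      ∑' k, ‖ζ k‖ₑ ^ 2 ≤ C * ∑' k, ‖β k‖ₑ ^ 2 := by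
  obtain ⟨m, hm1, hm⟩ : ∃ m : ℕ, 1 ≤ m ∧ ‖L ^ m‖ ≤ 1 / 2 := by
    have h1 := (tendsto_zero_iff_norm_tendsto_zero.1 hL).eventually (ge_mem_nhds
      (show (0 : ℝ) < 1 / 2 by norm_num))
    exact ((eventually_ge_atTop 1).and h1).exists
  -- An adapted norm. Applying `L` shifts the sum by one index, trading ‖z‖ for ‖L^m z‖ ≤ ‖z‖/2, so
  -- `V` drops by at least ‖z‖/2.
  let V : E → ℝ := fun z => ∑ i ∈ Finset.range m, ‖(L ^ i) z‖
  set c : ℝ := 1 + ∑ i ∈ Finset.range m, ‖L ^ i‖ with hc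
  have hc1 : 1 ≤ c := by
    rw [hc]; linarith [Finset.sum_nonneg (s := Finset.range m) (f := fun i => ‖L ^ i‖)
      fun _ _ => norm_nonneg _]
  have hVc : ∀ z, V z ≤ c * ‖z‖ := by
    intro z
    rw [hc, add_mul, Finset.sum_mul, one_mul]
    have : V z ≤ ∑ i ∈ Finset.range m, ‖L ^ i‖ * ‖z‖ :=
      Finset.sum_le_sum fun i _ => (L ^ i).le_opNorm z
    linarith [norm_nonneg z]
  have hV0 : ∀ z, ‖z‖ ≤ V z := by
    intro z
    exact Finset.single_le_sum (f := fun i => ‖(L ^ i) z‖) (s := Finset.range m)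
      (fun _ _ => norm_nonneg _) (Finset.mem_range.2 hm1)
  have hVL : ∀ z, V (L z) ≤ V z - ‖z‖ / 2 := by
    intro z
    have h1 := Finset.sum_range_succ (fun i => ‖(L ^ i) z‖) m
    rw [Finset.sum_range_succ'] at h1
    have h2 : ∀ i, (L ^ (i + 1)) z = (L ^ i) (L z) := fun i => by rw [pow_succ]; rfl
    simp only [h2, pow_zero, one_apply_eq_self] at h1
    have h3 := (L ^ m).le_of_opNorm_le hm z
    change V (L z) + ‖z‖ = V z + _ at h1
    linarith
  have hVadd : ∀ x y, V (x + y) ≤ V x + V y := by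
    intro x y
    simp only [V, ← Finset.sum_add_distrib, map_add]
    exact Finset.sum_le_sum fun i _ => norm_add_le _ _
  -- As V ≤ c‖·‖, the drop ‖z‖/2 is at least r V(z), so `L` contracts `V` by the factor 1 − r.
  set r : ℝ := 1 / (2 * c) with hr
  have hr0 : 0 < r := by positivity
  have hr1 : r ≤ 1 := by rw [hr, div_le_one (by positivity)]; linarith
  set D : ℝ := c ^ 2 / r with hD
  have hD0 : 0 ≤ D := by positivity
  have hstep : ∀ x b : E, V (L x + b) ^ 2 ≤ (1 - r) * V x ^ 2 + D * ‖b‖ ^ 2 := by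
    intro x b
    have h0 : ∀ z, 0 ≤ V z := fun z => (norm_nonneg z).trans (hV0 z)
    have h1 : V (L x + b) ≤ (1 - r) * V x + c * ‖b‖ := by
      have h2 : r * V x ≤ ‖x‖ / 2 := by
        rw [hr, div_mul_eq_mul_div, one_mul, div_le_iff₀ (by positivity)]
        linarith [hVc x]
      linarith [hVadd (L x) b, hVL x, hVc b]
    have h3 : V (L x + b) ^ 2 ≤ ((1 - r) * V x + c * ‖b‖) ^ 2 := pow_le_pow_left₀ (h0 _) h1 2
    refine h3.trans ?_
    have h4 : D * ‖b‖ ^ 2 = (c * ‖b‖) ^ 2 / r := by rw [hD]; ring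
    rw [h4, ← sub_le_iff_le_add', le_div_iff₀ hr0]
    -- With a = V x and β = c‖b‖: (1−r)a² + β²/r − ((1−r)a + β)² = (1−r)(ra − β)²/r.
    nlinarith [mul_nonneg (sub_nonneg.2 hr1) (sq_nonneg (r * V x - c * ‖b‖))]
  refine ⟨(D / r).toNNReal, fun ζ β h0 hrec => ?_⟩
  -- Telescoping of the one-step inequality; the boundary term V(ζ K)² is kept so that the induction
  -- closes.
  have hsum : ∀ K, r * ∑ k ∈ Finset.range K, V (ζ k) ^ 2 + V (ζ K) ^ 2 ≤
      D * ∑ k ∈ Finset.range K, ‖β k‖ ^ 2 := by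
    intro K
    induction K with
    | zero => simp [h0, V]
    | succ K ih =>
      rw [Finset.sum_range_succ, Finset.sum_range_succ, hrec]
      linarith [hstep (ζ K) (β K)]
  refine ENNReal.tsum_le_of_sum_range_le fun K => ?_
  have h1 : ∑ k ∈ Finset.range K, ‖ζ k‖ ^ 2 ≤ D / r * ∑ k ∈ Finset.range K, ‖β k‖ ^ 2 := by
    rw [div_mul_eq_mul_div, le_div_iff₀ hr0, mul_comm]
    refine le_trans ?_ ((le_add_of_nonneg_right (sq_nonneg (V (ζ K)))).trans (hsum K))
    gcongr
    exact hV0 _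
  refine le_trans ?_ (mul_le_mul_right (ENNReal.sum_le_tsum (Finset.range K)) _)
  have h2 : ∀ γ : ℕ → E, ∑ k ∈ Finset.range K, ‖γ k‖ₑ ^ 2 =
      ENNReal.ofReal (∑ k ∈ Finset.range K, ‖γ k‖ ^ 2) := by
    intro γ
    rw [ENNReal.ofReal_sum_of_nonneg fun _ _ => by positivity]
    refine Finset.sum_congr rfl fun k _ => ?_
    rw [ENNReal.ofReal_pow (norm_nonneg _), ofReal_norm]
  rw [h2, h2]
  refine (ENNReal.ofReal_le_ofReal h1).trans (le_of_eq ?_)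
  rw [ENNReal.ofReal_mul (by positivity)]
  rfl

end Stability

section EvolutionBound

/-- The flow is bounded on `[0, h]`, and Cauchy–Schwarz bounds the integral of the forcing. The
constant is uniform over all windows δ ≤ h, so the factor δ can be made small. -/
lemma exists_enorm_evol_shift_sq_le {ι : Type*} [Fintype ι] [DecidableEq ι] (A : Matrix ι ι ℝ)
    (h : ℝ) : ∃ C : ℝ≥0, ∀ f : ℝ → EuclideanSpace ℝ ι, LocInt f → ∀ a δ s : ℝ, 0 ≤ a →
      0 ≤ s → s ≤ δ → δ ≤ h → ‖evol A (fun τ => f (a + τ)) s‖ₑ ^ 2 ≤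
        C * ENNReal.ofReal δ * ∫⁻ t in Set.Ico a (a + δ), ‖f t‖ₑ ^ 2 := by
  obtain ⟨C, hC0, hC⟩ := exists_norm_flow_le A h
  refine ⟨(C ^ 2).toNNReal, fun f hf a δ s ha hs hsδ hδ => ?_⟩
  have h1 := enorm_evol_le (f := fun τ => f (a + τ)) hC hs (hsδ.trans hδ)
  have h2 : ∫⁻ τ in Set.Ico 0 s, ‖f (a + τ)‖ₑ ≤ ∫⁻ t in Set.Ico a (a + δ), ‖f t‖ₑ := by
    refine (lintegral_mono_set (Set.Ico_subset_Ico_right hsδ)).trans (le_of_eq ?_)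
    have := (measurePreserving_add_left volume a).setLIntegral_comp_preimage_emb
      (measurableEmbedding_addLeft a) (fun t => ‖f t‖ₑ) (Set.Ico a (a + δ))
    rw [← this]
    simp
  refine (pow_le_pow_left' (h1.trans (mul_le_mul_right h2 _)) 2).trans ?_
  rw [mul_pow, mul_assoc, ← ENNReal.ofReal_pow hC0.le]
  exact mul_le_mul_right (sq_lintegral_enorm_le hf ha) _

lemma enorm_cell_le {m : ℕ} {h : ℝ} (hh : 0 < h) {N : ℕ} (hN : 0 < N)
    (q : EuclideanSpace ℝ (Fin N × Fin m)) {s : ℝ} (hs : 0 ≤ s) (hsh : s < h) :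
    ‖cell h N q s‖ₑ ^ 2 ≤ ‖q‖ₑ ^ 2 := by
  set j : Fin N := ⟨⌊s / (h / N)⌋₊, floor_slot_lt hh hN hs hsh⟩
  have h1 : cell h N q s = WithLp.toLp 2 fun c => q (j, c) := by
    ext c; exact cell_apply hh hN q hs hsh c
  have h2 : q = stack fun i => WithLp.toLp 2 fun c => q (i, c) := rfl
  rw [h1]
  nth_rw 2 [h2]
  rw [enorm_stack_sq]
  exact Finset.single_le_sum (f := fun i : Fin N => ‖(WithLp.toLp 2 fun c => q (i, c) :
    EuclideanSpace ℝ (Fin m))‖ₑ ^ 2) (fun _ _ => zero_le) (Finset.mem_univ j)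

end EvolutionBound

/-! ### Energy bounds for the closed loop -/

section

lemma enorm_pair_sq {σ τ : Type*} [Fintype σ] [Fintype τ] (x : EuclideanSpace ℝ σ)
    (ξ : EuclideanSpace ℝ τ) : ‖pair x ξ‖ₑ ^ 2 = ‖x‖ₑ ^ 2 + ‖ξ‖ₑ ^ 2 := by
  simp only [← ofReal_norm, ← ENNReal.ofReal_pow (norm_nonneg _)]
  rw [norm_pair_sq, ENNReal.ofReal_add (by positivity) (by positivity)]

lemma two_mul_add_le (c d a b : ℝ≥0∞) : 2 * (c * a + d * b) ≤ 2 * (c + d) * (a + b) := by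
  calc 2 * (c * a + d * b) ≤ 2 * (c * (a + b) + d * (a + b)) := by
        gcongr
        · exact le_self_add
        · exact le_add_self
    _ = _ := by ring

variable {n nw nu nz ny nk : ℕ} {G : Plant n nw nu nz ny} {h : ℝ} {M₁ M₂ : ℕ}
  {Kd : Controller (Fin nk) (Fin M₁ × Fin ny) (Fin M₂ × Fin nu)}

/-- The energy of a signal on the `k`-th period. -/
def periodEnergy {m : ℕ} (h : ℝ) (w : ℝ → EuclideanSpace ℝ (Fin m)) (k : ℕ) : ℝ≥0∞ :=
  ∫⁻ t in Set.Ico (k * h) (k * h + h), ‖w t‖ₑ ^ 2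

namespace Plant.IsLoop

lemma exists_kick_bound (H : G.IsLoop h M₁ M₂ Kd) :
    ∃ C : ℝ≥0, ∀ w, LocInt w → ∀ (k : ℕ) (s : ℝ), 0 ≤ s → s ≤ h →
      ‖G.kick h w k s‖ₑ ^ 2 ≤ C * periodEnergy h w k := by
  have hh := H.period_pos
  obtain ⟨C, hC⟩ := exists_enorm_evol_shift_sq_le G.A h
  refine ⟨C * h.toNNReal * ‖mat G.B₁‖₊ ^ 2, fun w hw k s hs hsh => ?_⟩
  refine (hC _ (hw.clm (mat G.B₁)) (k * h) h s (by positivity) hs hsh le_rfl).trans ?_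
  rw [ENNReal.coe_mul, ENNReal.coe_mul, mul_assoc (_ * _)]
  refine mul_le_mul_right ?_ _
  rw [periodEnergy, ← lintegral_const_mul' _ _ ENNReal.coe_ne_top]
  exact lintegral_mono fun t => enorm_clm_sq_le _ _

lemma exists_kickOut_bound (H : G.IsLoop h M₁ M₂ Kd) :
    ∃ C : ℝ≥0, ∀ w, LocInt w → ∀ k : ℕ,
      ‖G.kickOut h M₁ w k‖ₑ ^ 2 ≤ C * periodEnergy h w k := by
  obtain ⟨C, hC⟩ := H.exists_kick_bound
  refine ⟨M₁ * (‖mat G.C₂‖₊ ^ 2 * C), fun w hw k => ?_⟩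
  rw [kickOut, enorm_stack_sq]
  calc _ ≤ ∑ _i : Fin M₁, ((‖mat G.C₂‖₊ ^ 2 * C : ℝ≥0) : ℝ≥0∞) * periodEnergy h w k := by
        refine Finset.sum_le_sum fun i _ => (enorm_clm_sq_le _ _).trans ?_
        rw [ENNReal.coe_mul, mul_assoc]
        exact mul_le_mul_right (hC w hw k _ (slot_time_nonneg H.period_pos i)
          (slot_time_lt H.period_pos i).le) _
    _ = _ := by simp [mul_assoc]

/-- The terms driving the recursion are bounded period by period by the energy of `w`, so
ℓ²-stability of the recursion sums them. -/
lemma exists_loopState_bound (H : G.IsLoop h M₁ M₂ Kd) (hst : G.Stable h M₁ M₂ Kd) :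
    ∃ C : ℝ≥0, ∀ w, LocInt w →
      ∑' k, ‖G.loopState h M₁ M₂ Kd w k‖ₑ ^ 2 ≤ C * ∑' k, periodEnergy h w k := by
  obtain ⟨C₁, hC₁⟩ := H.exists_kick_bound
  obtain ⟨C₂, hC₂⟩ := H.exists_kickOut_bound
  have hL : Tendsto (fun k : ℕ => mat (G.closedLoop h M₁ M₂ Kd) ^ k) atTop (𝓝 0) := by
    have h1 := (continuous_mat.tendsto _).comp hst
    have h0 : mat (0 : Matrix (Fin n ⊕ Fin nk) (Fin n ⊕ Fin nk) ℝ) = 0 := by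
      ext v : 1; exact mat_zero v
    rw [h0] at h1
    exact h1.congr fun k => mat_pow _ k
  obtain ⟨C, hC⟩ := exists_l2_bound _ hL
  set P := G.Bh h M₂ * Kd.D * G.loopInv h M₁ M₂ Kd
  set Q := Kd.B * G.loopInv h M₁ M₂ Kd
  refine ⟨C * (2 * (C₁ + ‖mat P‖₊ ^ 2 * C₂) + ‖mat Q‖₊ ^ 2 * C₂), fun w hw => ?_⟩
  refine (hC _ _ (loopState_zero w) (H.loopState_succ hw)).trans ?_
  rw [ENNReal.coe_mul, mul_assoc]
  refine mul_le_mul_right ?_ _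
  rw [← ENNReal.tsum_mul_left]
  refine ENNReal.tsum_le_tsum fun k => ?_
  rw [enorm_pair_sq]
  have hk := hC₂ w hw k
  calc _ ≤ 2 * (C₁ * periodEnergy h w k + (‖mat P‖₊ ^ 2 : ℝ≥0) * (C₂ * periodEnergy h w k)) +
        (‖mat Q‖₊ ^ 2 : ℝ≥0) * (C₂ * periodEnergy h w k) := by
        refine add_le_add ((enorm_add_sq_le _ _).trans ?_) ((enorm_clm_sq_le _ _).trans ?_)
        · refine mul_le_mul_right (add_le_add (hC₁ w hw k h H.period_pos.le le_rfl) ?_) _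
          exact (enorm_clm_sq_le _ _).trans (mul_le_mul_right hk _)
        · exact mul_le_mul_right hk _
    _ = _ := by push_cast; ring

/-- The closed loop is internally `L²`-stable: the plant state and the control are dominated
period by period by a summable sequence. -/
lemma exists_trajectory_bound (H : G.IsLoop h M₁ M₂ Kd) (hst : G.Stable h M₁ M₂ Kd) :
    ∃ C : ℝ≥0, ∀ w, LocInt w → ∃ b : ℕ → ℝ≥0∞,
      ∑' k, b k ≤ C * ∫⁻ t in Set.Ici 0, ‖w t‖ₑ ^ 2 ∧
      (∀ (k : ℕ) (s : ℝ), 0 ≤ s → s ≤ h →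
        ‖G.plantState h M₁ M₂ Kd w (k * h + s)‖ₑ ^ 2 ≤ b k) ∧
      ∀ k, ‖G.loopIn h M₁ M₂ Kd w k‖ₑ ^ 2 ≤ b k := by
  have hh := H.period_pos
  obtain ⟨C₁, hC₁⟩ := H.exists_kick_bound
  obtain ⟨C₂, hC₂⟩ := H.exists_kickOut_bound
  obtain ⟨C₃, hC₃⟩ := H.exists_loopState_bound hst
  obtain ⟨Ce, hCe⟩ := exists_enorm_evol_shift_sq_le G.A h
  obtain ⟨Cf, hCf0, hCf⟩ := exists_norm_flow_le G.A h
  set U := G.inputGain h M₁ M₂ Kd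
  set V := Kd.D * G.loopInv h M₁ M₂ Kd
  set Cu : ℝ≥0 := 2 * (‖mat U‖₊ ^ 2 + ‖mat V‖₊ ^ 2 * C₂) with hCu
  set Cb : ℝ≥0 := Ce * h.toNNReal * (‖mat G.B₂‖₊ ^ 2 * h.toNNReal) with hCb
  set Cf' : ℝ≥0 := (Cf ^ 2).toNNReal with hCf'
  set Cx : ℝ≥0 := 2 * (2 * (Cf' + Cb * Cu) + C₁) with hCx
  set ζ := G.loopState h M₁ M₂ Kd
  -- The dominating term combines the joint state at the start of the period with the energy of `w`
  -- during it; summing the first part costs `C₃`, the second costs 1.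
  refine ⟨(Cu + Cx) * (C₃ + 1), fun w hw =>
    ⟨fun k => ((Cu + Cx : ℝ≥0) : ℝ≥0∞) * (‖ζ w k‖ₑ ^ 2 + periodEnergy h w k), ?_, ?_, ?_⟩⟩
  · rw [ENNReal.tsum_mul_left, ENNReal.tsum_add, lintegral_periods hh, ENNReal.coe_mul, mul_assoc]
    refine mul_le_mul_right ?_ _
    rw [ENNReal.coe_add, add_mul, ENNReal.coe_one, one_mul]
    exact add_le_add_left (hC₃ w hw) _
  all_goals
    have hu : ∀ k, ‖G.loopIn h M₁ M₂ Kd w k‖ₑ ^ 2 ≤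
        Cu * (‖ζ w k‖ₑ ^ 2 + periodEnergy h w k) := by
      intro k
      rw [H.loopIn_eq hw]
      calc _ ≤ 2 * ((‖mat U‖₊ ^ 2 : ℝ≥0) * ‖ζ w k‖ₑ ^ 2 +
            ((‖mat V‖₊ ^ 2 * C₂ : ℝ≥0) : ℝ≥0∞) * periodEnergy h w k) := by
            refine (enorm_add_sq_le _ _).trans (mul_le_mul_right (add_le_add
              (enorm_clm_sq_le _ _) ((enorm_clm_sq_le _ _).trans ?_)) _)
            rw [ENNReal.coe_mul, mul_assoc]
            exact mul_le_mul_right (hC₂ w hw k) _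
        _ ≤ _ := two_mul_add_le _ _ _ _
        _ = _ := by rw [hCu]; push_cast; ring
  · intro k s hs hsh
    have hB : ‖evol G.A (fun τ => mat G.B₂ (cell h M₂ (G.loopIn h M₁ M₂ Kd w k) τ)) s‖ₑ ^ 2 ≤
        Cb * ‖G.loopIn h M₁ M₂ Kd w k‖ₑ ^ 2 := by
      have h1 := hCe _ ((locInt_cell hh H.outputs_pos (G.loopIn h M₁ M₂ Kd w k)).clm
        (mat G.B₂)) 0 h s le_rfl hs hsh le_rfl
      simp only [zero_add] at h1
      refine h1.trans ?_
      rw [hCb, ENNReal.coe_mul, ENNReal.coe_mul, mul_assoc (_ * _)]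
      refine mul_le_mul_right ?_ _
      refine (setLIntegral_mono' (g := fun _ => ((‖mat G.B₂‖₊ ^ 2 : ℝ≥0) : ℝ≥0∞) *
        ‖G.loopIn h M₁ M₂ Kd w k‖ₑ ^ 2) measurableSet_Ico fun τ hτ => ?_).trans ?_
      · exact (enorm_clm_sq_le _ _).trans (mul_le_mul_right
          (enorm_cell_le hh H.outputs_pos _ hτ.1 hτ.2) _)
      · rw [setLIntegral_const, Real.volume_Ico, sub_zero, ENNReal.coe_mul]
        refine le_of_eq ?_
        rw [mul_right_comm]; rfl
    have hA : ‖flow G.A s (G.plantState h M₁ M₂ Kd w (k * h))‖ₑ ^ 2 ≤ Cf' * ‖ζ w k‖ₑ ^ 2 := by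
      refine (enorm_clm_sq_le _ _).trans (mul_le_mul' ?_ ?_)
      · rw [ENNReal.coe_le_coe, hCf', ← NNReal.coe_le_coe,
          Real.coe_toNNReal _ (by positivity)]
        push_cast
        exact pow_le_pow_left₀ (norm_nonneg _) (hCf s hs hsh) 2
      · change _ ≤ ‖pair _ _‖ₑ ^ 2
        rw [enorm_pair_sq]
        exact le_self_add
    rw [H.plantState_period hw k hs hsh]
    set a := ‖ζ w k‖ₑ ^ 2
    set W := periodEnergy h w k
    calc _ ≤ 2 * (2 * (Cf' * a + Cb * (Cu * (a + W))) + C₁ * W) := by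
          refine (enorm_add_sq_le _ _).trans (mul_le_mul_right (add_le_add
            ((enorm_add_sq_le _ _).trans (mul_le_mul_right (add_le_add hA
              (hB.trans (mul_le_mul_right (hu k) _))) _)) (hC₁ w hw k s hs hsh)) _)
      _ ≤ 2 * (2 * (Cf' * (a + W) + Cb * (Cu * (a + W))) + C₁ * (a + W)) := by
          gcongr
          · exact le_self_add
          · exact le_add_self
      _ = Cx * (a + W) := by rw [hCx]; push_cast; ring
      _ ≤ _ := by
          refine mul_le_mul_left ?_ _
          rw [ENNReal.coe_add]; exact le_add_self
  · intro k
    refine (hu k).trans (mul_le_mul_left ?_ _)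
    rw [ENNReal.coe_add]; exact le_self_add

end Plant.IsLoop

end

/-! ### Error of sampling followed by holding -/

section Resample

variable {E : Type*} [NormedAddCommGroup E]

/-- Ideal sampling followed by a zero-order hold of the same period. -/
def resample (δ : ℝ) (z : ℝ → E) : ℝ → E := hold δ (sampler δ z)

lemma hold_apply_of_mem {E : Type*} {δ : ℝ} (hδ : 0 < δ) (v : ℕ → E) (k : ℕ) {t : ℝ}
    (ht : t ∈ Set.Ico (k * δ) (k * δ + δ)) : hold δ v t = v k := by
  rw [hold, floor_div_eq hδ k ht]

lemma lintegral_hold_sq {δ : ℝ} (hδ : 0 < δ) (v : ℕ → E) :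
    ∫⁻ t in Set.Ici 0, ‖hold δ v t‖ₑ ^ 2 = ENNReal.ofReal δ * ∑' k, ‖v k‖ₑ ^ 2 := by
  rw [lintegral_periods hδ, ← ENNReal.tsum_mul_left]
  refine tsum_congr fun k => ?_
  rw [setLIntegral_congr_fun measurableSet_Ico
    (fun t ht => by rw [hold_apply_of_mem hδ v k ht]), setLIntegral_const, Real.volume_Ico,
    mul_comm, add_sub_cancel_left]

lemma tsum_lift_sq {m N : ℕ} (hN : 0 < N) (v : ℕ → EuclideanSpace ℝ (Fin m)) :
    ∑' k, ‖lift N v k‖ₑ ^ 2 = ∑' i, ‖v i‖ₑ ^ 2 := by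
  have : NeZero N := ⟨hN.ne'⟩
  rw [← (Nat.divModEquiv N).symm.tsum_eq (fun i => ‖v i‖ₑ ^ 2),
    ENNReal.tsum_prod (f := fun k i => ‖v ((Nat.divModEquiv N).symm (k, i))‖ₑ ^ 2)]
  refine tsum_congr fun k => ?_
  rw [lift_apply, enorm_stack_sq, tsum_fintype]
  refine Finset.sum_congr rfl fun i _ => ?_
  simp [Nat.divModEquiv, mul_comm, add_comm]

lemma resample_hold {E : Type*} {δ : ℝ} (hδ : 0 < δ) (v : ℕ → E) :
    resample δ (hold δ v) = hold δ v := by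
  funext t
  simp only [resample, hold, sampler]
  rw [mul_div_cancel_right₀ _ hδ.ne', Nat.floor_natCast]

lemma lintegral_sq_le_of_period_bound {h : ℝ} (hh : 0 < h) {f : ℝ → E} {b : ℕ → ℝ≥0∞}
    (hb : ∀ (k : ℕ) (s : ℝ), 0 ≤ s → s < h → ‖f (k * h + s)‖ₑ ^ 2 ≤ b k) :
    ∫⁻ t in Set.Ici 0, ‖f t‖ₑ ^ 2 ≤ ENNReal.ofReal h * ∑' k, b k := by
  rw [lintegral_periods hh, ← ENNReal.tsum_mul_left]
  refine ENNReal.tsum_le_tsum fun k => ?_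
  refine (setLIntegral_mono' (g := fun _ => b k) measurableSet_Ico fun t ht => ?_).trans ?_
  · have := hb k (t - k * h) (by linarith [ht.1]) (by linarith [ht.2])
    rwa [add_sub_cancel] at this
  · rw [setLIntegral_const, Real.volume_Ico, mul_comm, add_sub_cancel_left]

lemma resample_period {E : Type*} {h : ℝ} (hh : 0 < h) {N : ℕ} (hN : 0 < N) (z : ℝ → E)
    (k : ℕ) {s : ℝ} (hs : 0 ≤ s) :
    resample (h / N) z (k * h + s) = z (k * h + ⌊s / (h / N)⌋₊ * (h / N)) := by
  have : (N : ℝ) ≠ 0 := by positivity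
  simp only [resample, hold, sampler]
  rw [floor_period_add hh hN k hs]
  congr 1; push_cast; field_simp

/-- On a slot starting at kδ, the deviation is (e^{sA} − 1)x(kδ) plus the evolution of the forcing
from rest. The first is small relative to the sample, as the flow is continuous at 0; the second is
at most Cδ times the energy on the slot. Samples cannot be bounded by the energy of x, hence the
resampled energy on the right. -/
lemma exists_resample_evol_bound {ι : Type*} [Fintype ι] [DecidableEq ι] (A : Matrix ι ι ℝ)
    {ε : ℝ≥0} (hε : 0 < ε) : ∃ δ₀ : ℝ, 0 < δ₀ ∧ ∀ δ, 0 < δ → δ ≤ δ₀ →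
      ∀ f : ℝ → EuclideanSpace ℝ ι, LocInt f →
      ∫⁻ t in Set.Ici 0, ‖evol A f t - resample δ (evol A f) t‖ₑ ^ 2 ≤
        ε * ((∫⁻ t in Set.Ici 0, ‖resample δ (evol A f) t‖ₑ ^ 2) +
          ∫⁻ t in Set.Ici 0, ‖f t‖ₑ ^ 2) := by
  obtain ⟨C, hC⟩ := exists_enorm_evol_shift_sq_le A 1
  have hcont : Tendsto (fun s => ‖flow A s - 1‖₊ ^ 2) (𝓝 0) (𝓝 0) := by
    have h1 : Continuous fun s => ‖flow A s - 1‖₊ ^ 2 :=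
      (((continuous_flow A).sub continuous_const).nnnorm).pow 2
    have h2 := h1.tendsto 0
    have h3 : flow A 0 = 1 := by ext v : 1; exact flow_zero A v
    simpa [h3] using h2
  have hε2 : 0 < ε / 2 := by positivity
  obtain ⟨r, hr, hr'⟩ := Metric.eventually_nhds_iff.1 (hcont.eventually (ge_mem_nhds hε2))
  -- Integrating the forcing bound over a slot gives a second factor δ, so C d² must be small; d ≤ 1
  -- keeps δ in the range where `C` is valid.
  obtain ⟨d, hd0, hd1, hd⟩ : ∃ d : ℝ, 0 < d ∧ d ≤ 1 ∧ C * d ^ 2 ≤ (ε / 2 : ℝ) := by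
    have h1 : Tendsto (fun d : ℝ => C * d ^ 2) (𝓝[>] 0) (𝓝 0) := by
      have : Continuous fun d : ℝ => C * d ^ 2 := by fun_prop
      simpa using (this.tendsto 0).mono_left nhdsWithin_le_nhds
    have h2 := h1.eventually (ge_mem_nhds (show (0 : ℝ) < ε / 2 from by exact_mod_cast hε2))
    have h3 : ∀ᶠ d : ℝ in 𝓝[>] 0, d ∈ Set.Ioc (0 : ℝ) 1 := Ioc_mem_nhdsGT one_pos
    obtain ⟨d, hd, hd'⟩ := (h2.and h3).exists
    exact ⟨d, hd'.1, hd'.2, hd⟩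
  refine ⟨min d (r / 2), by positivity, fun δ hδ hδ' f hf => ?_⟩
  have hδd : δ ≤ d := hδ'.trans (min_le_left _ _)
  have hδr : δ < r := (hδ'.trans (min_le_right _ _)).trans_lt (by linarith)
  rw [resample, lintegral_hold_sq hδ, lintegral_periods hδ, lintegral_periods hδ,
    ← ENNReal.tsum_mul_left, ← ENNReal.tsum_add, ← ENNReal.tsum_mul_left]
  refine ENNReal.tsum_le_tsum fun k => ?_
  have hk : (0 : ℝ) ≤ k * δ := by positivity
  set I := ∫⁻ t in Set.Ico (k * δ) (k * δ + δ), ‖f t‖ₑ ^ 2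
  set X := ‖sampler δ (evol A f) k‖ₑ ^ 2 with hX
  have hpt : ∀ t ∈ Set.Ico (k * δ) (k * δ + δ),
      ‖evol A f t - hold δ (sampler δ (evol A f)) t‖ₑ ^ 2 ≤
        2 * ((ε / 2 : ℝ≥0) * X + C * ENNReal.ofReal δ * I) := by
    intro t ht
    have hs0 : 0 ≤ t - k * δ := by linarith [ht.1]
    have hs1 : t - k * δ ≤ δ := by linarith [ht.2]
    have h1 : evol A f t = flow A (t - k * δ) (evol A f (k * δ)) +
        evol A (fun τ => f (k * δ + τ)) (t - k * δ) := by
      rw [← evol_shift hf hk hs0, add_sub_cancel]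
    rw [hold_apply_of_mem hδ _ k ht, h1]
    have h2 : flow A (t - k * δ) (evol A f (k * δ)) +
        evol A (fun τ => f (k * δ + τ)) (t - k * δ) - sampler δ (evol A f) k =
        (flow A (t - k * δ) - 1) (sampler δ (evol A f) k) +
        evol A (fun τ => f (k * δ + τ)) (t - k * δ) := by
      simp only [sampler, sub_apply, one_apply_eq_self]
      abel
    rw [h2]
    refine (enorm_add_sq_le _ _).trans (mul_le_mul_right (add_le_add
      ((enorm_clm_sq_le _ _).trans (mul_le_mul_left ?_ _)) (hC f hf _ δ _ hk hs0 hs1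
        (hδd.trans hd1))) _)
    rw [ENNReal.coe_le_coe]
    apply hr'
    rw [Real.dist_eq, sub_zero, abs_of_nonneg hs0]
    exact hs1.trans_lt hδr
  refine (setLIntegral_mono' (g := fun _ => 2 * ((ε / 2 : ℝ≥0) * X + C * ENNReal.ofReal δ * I))
    measurableSet_Ico hpt).trans ?_
  rw [setLIntegral_const, Real.volume_Ico, add_sub_cancel_left]
  have hC2 : 2 * (C * (ENNReal.ofReal δ * ENNReal.ofReal δ)) ≤ ε := by
    rw [← ENNReal.ofReal_mul hδ.le]
    have : (C : ℝ≥0∞) = ENNReal.ofReal C := (ENNReal.ofReal_coe_nnreal).symm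
    rw [this, ← ENNReal.ofReal_mul C.coe_nonneg, show (2 : ℝ≥0∞) = ENNReal.ofReal 2 by simp,
      ← ENNReal.ofReal_mul (by norm_num), ← ENNReal.ofReal_coe_nnreal (p := ε)]
    refine ENNReal.ofReal_le_ofReal ?_
    have h1 : (C : ℝ) * (δ * δ) ≤ C * d ^ 2 := by rw [sq]; gcongr
    linarith
  have hE2 : 2 * ((ε / 2 : ℝ≥0) : ℝ≥0∞) = ε := by
    rw [show (2 : ℝ≥0∞) = ((2 : ℝ≥0) : ℝ≥0∞) by simp, ← ENNReal.coe_mul,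
      mul_div_cancel₀ _ two_ne_zero]
  calc 2 * ((ε / 2 : ℝ≥0) * X + C * ENNReal.ofReal δ * I) * ENNReal.ofReal δ
      = 2 * ((ε / 2 : ℝ≥0) : ℝ≥0∞) * (ENNReal.ofReal δ * X) +
        2 * (C * (ENNReal.ofReal δ * ENNReal.ofReal δ)) * I := by ring
    _ ≤ ε * (ENNReal.ofReal δ * X) + ε * I := by rw [hE2]; gcongr
    _ = _ := by ring

/-- The two signals differ at t only if the last sampling instant precedes the start of the hold
interval containing t, so t lies within δ of that start; by δ ≤ a the sampled value is then the
preceding one. The period δ need not divide a. -/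
lemma lintegral_resample_hold_sq_le {δ a : ℝ} (hδ : 0 < δ) (hδa : δ ≤ a) (v : ℕ → E) :
    ∫⁻ t in Set.Ici 0, ‖hold a v t - resample δ (hold a v) t‖ₑ ^ 2 ≤
      6 * ENNReal.ofReal δ * ∑' k, ‖v k‖ₑ ^ 2 := by
  have ha : 0 < a := hδ.trans_le hδa
  have hpt : ∀ (k : ℕ), ∀ t ∈ Set.Ico (k * a) (k * a + a),
      ‖hold a v t - resample δ (hold a v) t‖ₑ ^ 2 ≤
        (Set.Ico (k * a) (k * a + δ)).indicator
          (fun _ => 2 * (‖v k‖ₑ ^ 2 + ‖v (k - 1)‖ₑ ^ 2)) t := by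
    intro k t ht
    have ht0 : 0 ≤ t := le_trans (by positivity) ht.1
    set p : ℝ := ⌊t / δ⌋₊ * δ with hp
    have hp0 : 0 ≤ p := by positivity
    have hp1 : p ≤ t := by
      rw [hp, ← le_div_iff₀ hδ]; exact Nat.floor_le (by positivity)
    have hp2 : t < p + δ := by
      rw [hp, ← add_one_mul, ← div_lt_iff₀ hδ]; exact Nat.lt_floor_add_one _
    have hres : resample δ (hold a v) t = hold a v p := rfl
    rw [hres, hold_apply_of_mem ha v k ht]
    rcases le_or_gt (k * a) p with hkp | hkp
    · rw [hold_apply_of_mem ha v k ⟨hkp, hp1.trans_lt ht.2⟩]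
      simp
    · have hk : k ≠ 0 := by
        rintro rfl
        simp only [Nat.cast_zero, zero_mul] at hkp
        linarith
      have hcast : ((k - 1 : ℕ) : ℝ) = k - 1 := by
        rw [Nat.cast_sub (by omega), Nat.cast_one]
      rw [hold_apply_of_mem ha v (k - 1) ⟨by rw [hcast]; linarith [ht.1],
        by rw [hcast]; linarith⟩, Set.indicator_of_mem
          (show t ∈ Set.Ico (k * a) (k * a + δ) from ⟨ht.1, by linarith⟩)]
      exact enorm_sub_sq_le _ _
  rw [lintegral_periods ha]
  -- Truncated subtraction counts `v 0` twice, whence the factor 2 and the final constant 6 = 2(1 +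
  -- 2).
  have hshift : ∑' k : ℕ, ‖v (k - 1)‖ₑ ^ 2 ≤ 2 * ∑' k, ‖v k‖ₑ ^ 2 := by
    rw [tsum_eq_zero_add' ENNReal.summable, two_mul]
    exact add_le_add (ENNReal.le_tsum (f := fun k => ‖v k‖ₑ ^ 2) 0) le_rfl
  calc _ ≤ ∑' k : ℕ, 2 * ENNReal.ofReal δ * (‖v k‖ₑ ^ 2 + ‖v (k - 1)‖ₑ ^ 2) := by
        refine ENNReal.tsum_le_tsum fun k => (setLIntegral_mono' measurableSet_Ico (hpt k)).trans ?_
        rw [lintegral_indicator measurableSet_Ico, setLIntegral_const]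
        refine (mul_le_mul_right (Measure.restrict_apply_le _ _) _).trans (le_of_eq ?_)
        rw [Real.volume_Ico, add_sub_cancel_left]
        ring
    _ = 2 * ENNReal.ofReal δ * (∑' k, ‖v k‖ₑ ^ 2 + ∑' k : ℕ, ‖v (k - 1)‖ₑ ^ 2) := by
        rw [ENNReal.tsum_mul_left, ENNReal.tsum_add]
    _ ≤ 2 * ENNReal.ofReal δ * (∑' k, ‖v k‖ₑ ^ 2 + 2 * ∑' k, ‖v k‖ₑ ^ 2) := by gcongr
    _ = _ := by ring

end Resample

/-! ### Density of held inputs and uniform closeness of resampled outputs -/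

section

section Density

variable {E : Type*} [NormedAddCommGroup E]

lemma aestronglyMeasurable_hold (δ : ℝ) (v : ℕ → E) :
    AEStronglyMeasurable (hold δ v) timeMeasure :=
  (stronglyMeasurable_hold δ v).aestronglyMeasurable

lemma eLpNorm_le_of_lintegral_sq_le {α β F : Type*} [MeasurableSpace α] [MeasurableSpace β]
    [NormedAddCommGroup F] {μ : Measure α} {ν : Measure β} {f : α → E} {g : β → F} (c : ℝ≥0∞)
    (hfg : ∫⁻ a, ‖f a‖ₑ ^ 2 ∂μ ≤ c ^ 2 * ∫⁻ b, ‖g b‖ₑ ^ 2 ∂ν) :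
    eLpNorm f 2 μ ≤ c * eLpNorm g 2 ν := by
  rw [← eLpNorm_two_sq, ← eLpNorm_two_sq, ← mul_pow] at hfg
  exact (ENNReal.pow_le_pow_left_iff two_ne_zero).1 hfg

lemma eLpNorm_clm_le {α F : Type*} [MeasurableSpace α] [NormedSpace ℝ E] [NormedAddCommGroup F]
    [NormedSpace ℝ F] (L : E →L[ℝ] F) (f : α → E) (μ : Measure α) :
    eLpNorm (fun t => L (f t)) 2 μ ≤ ‖L‖₊ * eLpNorm f 2 μ := by
  refine eLpNorm_le_of_lintegral_sq_le _ ?_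
  rw [← ENNReal.coe_pow, ← lintegral_const_mul' _ _ ENNReal.coe_ne_top]
  exact lintegral_mono fun t => enorm_clm_sq_le _ _

/-- Dominated convergence: the last sampling instant before t tends to t, and g is continuous. -/
lemma tendsto_lintegral_sub_resample_sq [NormedSpace ℝ E] {h : ℝ} (hh : 0 < h) {g : ℝ → E}
    (hg : Continuous g) (hgc : HasCompactSupport g) :
    Tendsto (fun N : ℕ => ∫⁻ t in Set.Ici 0, ‖g t - resample (h / N) g t‖ₑ ^ 2) atTop (𝓝 0) := by
  obtain ⟨R, hR0, hR⟩ := hgc.exists_pos_le_norm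
  obtain ⟨M, hM⟩ := hgc.exists_bound_of_continuous hg
  have hzero : ∫⁻ _t in Set.Ici (0 : ℝ), (0 : ℝ≥0∞) = 0 := by simp
  rw [← hzero]
  have hfloor : ∀ N : ℕ, 0 < N → ∀ t : ℝ, 0 ≤ t → ⌊t / (h / N)⌋₊ * (h / N) ≤ t ∧
      t < ⌊t / (h / N)⌋₊ * (h / N) + h / N := by
    intro N hN t ht
    have hδ : 0 < h / N := by positivity
    refine ⟨?_, ?_⟩
    · rw [← le_div_iff₀ hδ]; exact Nat.floor_le (by positivity)
    · rw [← add_one_mul, ← div_lt_iff₀ hδ]; exact Nat.lt_floor_add_one _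
  refine tendsto_lintegral_filter_of_dominated_convergence
    -- Sampling lags by at most h/N ≤ h, so beyond `R + h` both g and its resampled version vanish,
    -- for every N > 0.
    ((Set.Ico 0 (R + h)).indicator fun _ => ENNReal.ofReal (M + M) ^ 2) ?_ ?_ ?_ ?_
  · refine Eventually.of_forall fun N => ?_
    exact ((hg.stronglyMeasurable.sub (stronglyMeasurable_hold _ _)).enorm.pow_const 2)
  · filter_upwards [eventually_gt_atTop 0] with N hN
    refine (ae_restrict_iff' measurableSet_Ici).2 (ae_of_all _ fun t ht => ?_)
    obtain ⟨h1, h2⟩ := hfloor N hN t ht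
    have hle : h / N ≤ h := div_le_self hh.le (by exact_mod_cast hN)
    by_cases htR : t < R + h
    · rw [Set.indicator_of_mem (show t ∈ Set.Ico 0 (R + h) from ⟨ht, htR⟩), ← ofReal_norm]
      refine pow_le_pow_left' (ENNReal.ofReal_le_ofReal ?_) 2
      exact (norm_sub_le _ _).trans (add_le_add (hM _) (hM _))
    · have h3 : g t = 0 := hR t (by
        rw [Real.norm_eq_abs]; exact le_trans (by linarith) (le_abs_self t))
      have h4 : resample (h / N) g t = 0 := hR _ (by
        rw [Real.norm_eq_abs]; exact le_trans (by linarith) (le_abs_self _))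
      simp [h3, h4]
  · rw [lintegral_indicator measurableSet_Ico, setLIntegral_const]
    refine ENNReal.mul_ne_top (by simp) ?_
    exact ((Measure.restrict_apply_le _ _).trans_lt (by simp)).ne
  · refine (ae_restrict_iff' measurableSet_Ici).2 (ae_of_all _ fun t ht => ?_)
    have hlim : Tendsto (fun N : ℕ => (⌊t / (h / N)⌋₊ : ℝ) * (h / N)) atTop (𝓝 t) := by
      have h0 : Tendsto (fun N : ℕ => t - h / N) atTop (𝓝 t) := by
        simpa using tendsto_const_nhds.sub (tendsto_const_div_atTop_nhds_zero_nat h)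
      refine tendsto_of_tendsto_of_tendsto_of_le_of_le' h0 tendsto_const_nhds ?_ ?_
      · filter_upwards [eventually_gt_atTop 0] with N hN
        linarith [(hfloor N hN t ht).2]
      · filter_upwards [eventually_gt_atTop 0] with N hN using (hfloor N hN t ht).1
    have h1 : Tendsto (fun N : ℕ => g t - resample (h / N) g t) atTop (𝓝 0) := by
      have := (tendsto_const_nhds (x := g t)).sub ((hg.tendsto t).comp hlim)
      rwa [sub_self] at this
    have h2 := (ENNReal.continuous_pow 2).tendsto _ |>.comp h1.enorm
    rwa [enorm_zero, zero_pow two_ne_zero] at h2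

/-- Piecewise constant signals with step `h / N` become dense in `L²[0, ∞)`. -/
lemma eventually_exists_hold_close [NormedSpace ℝ E] {h : ℝ} (hh : 0 < h)
    {w : ℝ → E} (hw : MemLp w 2 timeMeasure) {ε : ℝ≥0∞} (hε : ε ≠ 0) :
    ∀ᶠ N : ℕ in atTop, ∃ s : ℕ → E, eLpNorm (w - hold (h / N) s) 2 timeMeasure ≤ ε := by
  have hε2 : ε / 2 ≠ 0 := by simp [hε]
  have : IsLocallyFiniteMeasure timeMeasure := by unfold timeMeasure; infer_instance
  obtain ⟨g, hgc, hwg, hg, hg2⟩ := hw.exists_hasCompactSupport_eLpNorm_sub_le (by simp) hε2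
  have h1 := (tendsto_lintegral_sub_resample_sq hh hg hgc).eventually
    (ge_mem_nhds (show 0 < (ε / 2) ^ 2 from pos_of_ne_zero (pow_ne_zero 2 hε2)))
  filter_upwards [h1] with N hN
  refine ⟨sampler (h / N) g, ?_⟩
  have h2 : eLpNorm (g - resample (h / N) g) 2 timeMeasure ≤ ε / 2 := by
    rw [← ENNReal.pow_le_pow_left_iff two_ne_zero, eLpNorm_two_sq]
    exact hN
  have h3 : w - hold (h / N) (sampler (h / N) g) = (w - g) + (g - resample (h / N) g) := by
    simp [resample]
  rw [h3]
  refine (eLpNorm_add_le (hw.1.sub hg2.1)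
    (hg2.1.sub (aestronglyMeasurable_hold _ _)) one_le_two).trans ?_
  exact (add_le_add hwg h2).trans (ENNReal.add_halves ε).le

lemma lintegral_clm_add_sq_le {E F F' : Type*} [NormedAddCommGroup E] [NormedSpace ℝ E]
    [NormedAddCommGroup F] [NormedSpace ℝ F] [NormedAddCommGroup F'] [NormedSpace ℝ F']
    (L : F →L[ℝ] E) (L' : F' →L[ℝ] E) (f : ℝ → F) {g : ℝ → F'} (hg : StronglyMeasurable g) :
    ∫⁻ t in Set.Ici 0, ‖L (f t) + L' (g t)‖ₑ ^ 2 ≤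
      2 * ((‖L‖₊ ^ 2 : ℝ≥0) * (∫⁻ t in Set.Ici 0, ‖f t‖ₑ ^ 2) +
        (‖L'‖₊ ^ 2 : ℝ≥0) * ∫⁻ t in Set.Ici 0, ‖g t‖ₑ ^ 2) := by
  rw [← lintegral_const_mul' _ _ ENNReal.coe_ne_top, ← lintegral_const_mul' _ _ ENNReal.coe_ne_top,
    ← lintegral_add_right _ ((hg.enorm.pow_const 2).const_mul _),
    ← lintegral_const_mul' _ _ (by simp)]
  exact lintegral_mono fun t => (enorm_add_sq_le _ _).trans (mul_le_mul_right
    (add_le_add (enorm_clm_sq_le _ _) (enorm_clm_sq_le _ _)) _)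

end Density

variable {n nw nu nz ny nk : ℕ} {G : Plant n nw nu nz ny} {h : ℝ} {M₁ M₂ : ℕ}
  {Kd : Controller (Fin nk) (Fin M₁ × Fin ny) (Fin M₂ × Fin nu)}
  {K : (ℕ → EuclideanSpace ℝ (Fin ny)) → (ℕ → EuclideanSpace ℝ (Fin nu))}

namespace Plant.IsLoop

/-- The per-period bounds hold at every instant, so they also control samples of the plant state,
which its L² norm alone would not. -/
lemma exists_energy_bound (H : G.IsLoop h M₁ M₂ Kd) (hst : G.Stable h M₁ M₂ Kd) :
    ∃ C : ℝ≥0, ∀ w, LocInt w →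
      ∫⁻ t in Set.Ici 0, ‖G.plantState h M₁ M₂ Kd w t‖ₑ ^ 2 ≤
        C * ∫⁻ t in Set.Ici 0, ‖w t‖ₑ ^ 2 ∧
      (∀ N : ℕ, 0 < N → ∫⁻ t in Set.Ici 0, ‖resample (h / N) (G.plantState h M₁ M₂ Kd w) t‖ₑ ^ 2 ≤
        C * ∫⁻ t in Set.Ici 0, ‖w t‖ₑ ^ 2) ∧
      ∑' j, ‖unlift M₂ (G.loopIn h M₁ M₂ Kd w) j‖ₑ ^ 2 ≤
        C * ∫⁻ t in Set.Ici 0, ‖w t‖ₑ ^ 2 := by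
  have hh := H.period_pos
  obtain ⟨C, hC⟩ := H.exists_trajectory_bound hst
  refine ⟨(h.toNNReal + 1) * C, fun w hw => ?_⟩
  obtain ⟨b, hb, hx, hu⟩ := hC w hw
  set W := ∫⁻ t in Set.Ici 0, ‖w t‖ₑ ^ 2
  have hle : ENNReal.ofReal h * ∑' k, b k ≤ ((h.toNNReal + 1) * C : ℝ≥0) * W := by
    rw [ENNReal.coe_mul, mul_assoc]
    refine mul_le_mul' ?_ hb
    rw [ENNReal.coe_add]
    exact le_self_add
  refine ⟨?_, fun N hN => ?_, ?_⟩
  · exact (lintegral_sq_le_of_period_bound hh fun k s hs hsh => hx k s hs hsh.le).trans hle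
  · refine (lintegral_sq_le_of_period_bound hh fun k s hs hsh => ?_).trans hle
    have hδ : 0 < h / N := by positivity
    rw [resample_period hh hN _ k hs]
    refine hx k _ (by positivity) (le_trans ?_ hsh.le)
    rw [← le_div_iff₀ hδ]
    exact Nat.floor_le (by positivity)
  · rw [← tsum_lift_sq H.outputs_pos, lift_unlift H.outputs_pos]
    refine (ENNReal.tsum_le_tsum hu).trans (hb.trans ?_)
    refine mul_le_mul_left ?_ _
    rw [ENNReal.coe_le_coe, add_mul, one_mul]
    exact le_add_self

lemma lintegral_control_sq (H : G.IsLoop h M₁ M₂ Kd) (w : ℝ → EuclideanSpace ℝ (Fin nw)) :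
    ∫⁻ t in Set.Ici 0, ‖hold (h / M₂) (unlift M₂ (G.loopIn h M₁ M₂ Kd w)) t‖ₑ ^ 2 =
      (h / M₂).toNNReal * ∑' j, ‖unlift M₂ (G.loopIn h M₁ M₂ Kd w) j‖ₑ ^ 2 := by
  have hh := H.period_pos
  have hM := H.outputs_pos
  exact lintegral_hold_sq (by positivity) _

lemma exists_eLpNorm_bound (H : G.IsLoop h M₁ M₂ Kd) (hst : G.Stable h M₁ M₂ Kd)
    (hKd : liftedController M₁ M₂ K = discSys Kd.A Kd.B Kd.C Kd.D) :
    ∃ C : ℝ≥0, ∀ w, MemLp w 2 timeMeasure →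
      AEStronglyMeasurable (G.multirate h M₁ M₂ K w) timeMeasure ∧
      eLpNorm (G.multirate h M₁ M₂ K w) 2 timeMeasure ≤ C * eLpNorm w 2 timeMeasure := by
  obtain ⟨C, hC⟩ := H.exists_energy_bound hst
  set Cu : ℝ≥0 := (h / M₂).toNNReal * C with hCu
  refine ⟨‖mat G.C₁‖₊ * (C + 1) + ‖mat G.D₁₁‖₊ + ‖mat G.D₁₂‖₊ * (Cu + 1), fun w hw => ?_⟩
  have hwl := locInt_of_memLp hw
  obtain ⟨hx, -, hv⟩ := hC w hwl
  set x := G.plantState h M₁ M₂ Kd w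
  set v := unlift M₂ (G.loopIn h M₁ M₂ Kd w)
  set u := hold (h / M₂) v
  have hxm : AEStronglyMeasurable x timeMeasure :=
    (continuousOn_evol (H.locInt_forcing hwl)).aestronglyMeasurable measurableSet_Ici
  have hum : AEStronglyMeasurable u timeMeasure := aestronglyMeasurable_hold _ _
  have heq : G.multirate h M₁ M₂ K w =ᵐ[timeMeasure]
      (fun t => mat G.C₁ (x t)) + (fun t => mat G.D₁₁ (w t)) + fun t => mat G.D₁₂ (u t) :=
    (ae_restrict_iff' measurableSet_Ici).2 (ae_of_all _ fun t ht => H.multirate_apply hKd hwl ht)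
  have hm1 := (mat G.C₁).continuous.comp_aestronglyMeasurable hxm
  have hm2 := (mat G.D₁₁).continuous.comp_aestronglyMeasurable hw.1
  have hm3 := (mat G.D₁₂).continuous.comp_aestronglyMeasurable hum
  refine ⟨((hm1.add hm2).add hm3).congr heq.symm, ?_⟩
  -- Replacing √c by the larger c + 1 turns energy bounds into norm bounds without square roots.
  have hself : ∀ c : ℝ≥0, (c : ℝ≥0∞) ≤ ((c + 1 : ℝ≥0) : ℝ≥0∞) ^ 2 := by
    intro c
    rw [← ENNReal.coe_pow, ENNReal.coe_le_coe, ← NNReal.coe_le_coe]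
    push_cast
    nlinarith [c.coe_nonneg]
  have hx' : eLpNorm x 2 timeMeasure ≤ (C + 1 : ℝ≥0) * eLpNorm w 2 timeMeasure :=
    eLpNorm_le_of_lintegral_sq_le _ (hx.trans (mul_le_mul_left (hself C) _))
  have hu' : eLpNorm u 2 timeMeasure ≤ (Cu + 1 : ℝ≥0) * eLpNorm w 2 timeMeasure := by
    refine eLpNorm_le_of_lintegral_sq_le _ ((H.lintegral_control_sq w).le.trans ?_)
    refine (mul_le_mul_right hv _).trans ?_
    rw [← mul_assoc, ← ENNReal.coe_mul]
    exact mul_le_mul_left (hself Cu) _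
  rw [eLpNorm_congr_ae heq]
  refine (eLpNorm_add_le (hm1.add hm2) hm3 one_le_two).trans
    ((add_le_add_left (eLpNorm_add_le hm1 hm2 one_le_two) _).trans ?_)
  refine (add_le_add (add_le_add ((eLpNorm_clm_le _ x _).trans (mul_le_mul_right hx' _))
    (eLpNorm_clm_le _ w _)) ((eLpNorm_clm_le _ u _).trans (mul_le_mul_right hu' _))).trans
    (le_of_eq ?_)
  push_cast; ring

/-- On inputs that are constant on the sampling slots, sampling and holding the output of the
closed loop changes it little, uniformly in the input. -/
lemma eventually_resample_close (H : G.IsLoop h M₁ M₂ Kd) (hst : G.Stable h M₁ M₂ Kd)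
    (hKd : liftedController M₁ M₂ K = discSys Kd.A Kd.B Kd.C Kd.D) {ε : ℝ≥0} (hε : 0 < ε) :
    ∀ᶠ N : ℕ in atTop, ∀ s : ℕ → EuclideanSpace ℝ (Fin nw),
      eLpNorm (G.multirate h M₁ M₂ K (hold (h / N) s) -
        resample (h / N) (G.multirate h M₁ M₂ K (hold (h / N) s))) 2 timeMeasure ≤
      ε * eLpNorm (hold (h / N) s) 2 timeMeasure := by
  have hh := H.period_pos
  obtain ⟨C, hC⟩ := H.exists_energy_bound hst
  set Cf : ℝ≥0 := 2 * (‖mat G.B₁‖₊ ^ 2 + ‖mat G.B₂‖₊ ^ 2 * ((h / M₂).toNNReal * C)) with hCf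
  set P : ℝ≥0 := ‖mat G.C₁‖₊ ^ 2 * (C + Cf) with hP
  set Q : ℝ≥0 := ‖mat G.D₁₂‖₊ ^ 2 * C with hQ
  -- The state and control errors are each to contribute at most ε²/4; the factor 2 from squaring a
  -- sum is still to come. The 1 added to `P`, and to `Q` below, avoids division by zero.
  have hε₁ : 0 < ε ^ 2 / (4 * (P + 1)) := by positivity
  obtain ⟨δ₀, hδ₀, hx⟩ := exists_resample_evol_bound G.A hε₁
  have hlim := tendsto_const_div_atTop_nhds_zero_nat h
  have hM : (0 : ℝ) < h / M₂ := by have := H.outputs_pos; positivity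
  have hη : 0 < (ε : ℝ) ^ 2 / (24 * (Q + 1)) := by positivity
  filter_upwards [eventually_gt_atTop 0, hlim.eventually (ge_mem_nhds hδ₀),
    hlim.eventually (ge_mem_nhds hM), hlim.eventually (ge_mem_nhds hη)] with N hN h1 h2 h3 s
  have hδ : 0 < h / N := by positivity
  set w := hold (h / N) s with hw
  have hwl : LocInt w := locInt_hold hδ s
  obtain ⟨hxe, hxr, hv⟩ := hC w hwl
  set v := unlift M₂ (G.loopIn h M₁ M₂ Kd w) with hvdef
  set u := hold (h / M₂) v with hu
  set W := ∫⁻ t in Set.Ici 0, ‖w t‖ₑ ^ 2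
  set f : ℝ → EuclideanSpace ℝ (Fin n) := fun τ => mat G.B₁ (w τ) + mat G.B₂ (u τ)
  have hfe : ∫⁻ t in Set.Ici 0, ‖f t‖ₑ ^ 2 ≤ Cf * W := by
    refine (lintegral_clm_add_sq_le _ _ w (stronglyMeasurable_hold _ _)).trans ?_
    rw [hvdef, H.lintegral_control_sq w, ← hvdef]
    calc _ ≤ 2 * ((‖mat G.B₁‖₊ ^ 2 : ℝ≥0) * W + (‖mat G.B₂‖₊ ^ 2 : ℝ≥0) *
          ((h / M₂).toNNReal * (C * W))) := by gcongr
      _ = _ := by rw [hCf]; push_cast; ring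
  set x := G.plantState h M₁ M₂ Kd w with hxdef
  have hxx : ∫⁻ t in Set.Ici 0, ‖x t - resample (h / N) x t‖ₑ ^ 2 ≤
      (ε ^ 2 / (4 * (P + 1)) : ℝ≥0) * (C * W + Cf * W) :=
    (hx _ hδ h1 f (H.locInt_forcing hwl)).trans (mul_le_mul_right (add_le_add (hxr N hN) hfe) _)
  have huu : ∫⁻ t in Set.Ici 0, ‖u t - resample (h / N) u t‖ₑ ^ 2 ≤
      6 * ENNReal.ofReal (h / N) * (C * W) :=
    (lintegral_resample_hold_sq_le hδ h2 v).trans (mul_le_mul_right hv _)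
  have hpt : ∀ t ∈ Set.Ici (0 : ℝ), ‖(G.multirate h M₁ M₂ K w -
      resample (h / N) (G.multirate h M₁ M₂ K w)) t‖ₑ ^ 2 =
      ‖mat G.C₁ (x t - resample (h / N) x t) + mat G.D₁₂ (u t - resample (h / N) u t)‖ₑ ^ 2 := by
    intro t ht
    have h0 : resample (h / N) (G.multirate h M₁ M₂ K w) t =
        G.multirate h M₁ M₂ K w (⌊t / (h / N)⌋₊ * (h / N)) := rfl
    -- Here held inputs are essential: `w` is unchanged by resampling, so the feedthrough `D₁₁`
    -- contributes no error.
    have hwt : w (⌊t / (h / N)⌋₊ * (h / N)) = w t := congrFun (resample_hold hδ s) t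
    rw [Pi.sub_apply, h0, H.multirate_apply hKd hwl ht,
      H.multirate_apply hKd hwl (by positivity), hwt]
    congr 2
    rw [map_sub, map_sub]
    change _ = mat G.C₁ (x t) - mat G.C₁ (x (⌊t / (h / N)⌋₊ * (h / N))) +
      (mat G.D₁₂ (u t) - mat G.D₁₂ (u (⌊t / (h / N)⌋₊ * (h / N))))
    abel
  refine eLpNorm_le_of_lintegral_sq_le _ ?_
  change ∫⁻ t in Set.Ici 0, _ ≤ _ * W
  rw [setLIntegral_congr_fun measurableSet_Ici hpt]
  refine (lintegral_clm_add_sq_le _ _ (fun t => x t - resample (h / N) x t)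
    ((stronglyMeasurable_hold _ _).sub (stronglyMeasurable_hold _ _))).trans ?_
  set δ' : ℝ≥0 := (h / N).toNNReal with hδ'
  have hcoef : 2 * (P * (ε ^ 2 / (4 * (P + 1))) + Q * (6 * δ')) ≤ ε ^ 2 := by
    rw [← NNReal.coe_le_coe]
    push_cast
    rw [hδ', Real.coe_toNNReal _ hδ.le]
    have hP1 : (P : ℝ) * (ε ^ 2 / (4 * (P + 1))) ≤ ε ^ 2 / 4 := by
      rw [mul_div_assoc', div_le_div_iff₀ (by positivity) (by norm_num)]
      nlinarith [sq_nonneg (ε : ℝ), P.coe_nonneg]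
    have hQ1 : (Q : ℝ) * (6 * (h / N)) ≤ ε ^ 2 / 4 := by
      have : (Q : ℝ) * (6 * (h / N)) ≤ (Q + 1) * (6 * (ε ^ 2 / (24 * (Q + 1)))) := by
        gcongr; linarith
      refine this.trans (le_of_eq ?_)
      have : (Q : ℝ) + 1 ≠ 0 := by positivity
      field_simp; norm_num
    linarith
  calc _ ≤ 2 * ((‖mat G.C₁‖₊ ^ 2 : ℝ≥0) * ((ε ^ 2 / (4 * (P + 1)) : ℝ≥0) * (C * W + Cf * W)) +
        (‖mat G.D₁₂‖₊ ^ 2 : ℝ≥0) * (6 * ENNReal.ofReal (h / N) * (C * W))) := by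
        refine mul_le_mul_right (add_le_add (mul_le_mul_right hxx _) (mul_le_mul_right huu _)) _
    _ = ((2 * (P * (ε ^ 2 / (4 * (P + 1))) + Q * (6 * δ')) : ℝ≥0) : ℝ≥0∞) * W := by
        rw [hP, hQ, show ENNReal.ofReal (h / N) = (δ' : ℝ≥0∞) from rfl]
        push_cast; ring
    _ ≤ _ := by
        refine mul_le_mul_left ?_ _
        rw [← ENNReal.coe_pow]
        exact ENNReal.coe_le_coe.2 hcoef

end Plant.IsLoop

end

/-! ### Induced norms and their convergence -/

section

section InducedNorm

variable {α β E F : Type*} [MeasurableSpace α] [MeasurableSpace β] [NormedAddCommGroup E]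
  [NormedAddCommGroup F] {μ : Measure α} {ν : Measure β} {T : (α → E) → (β → F)}

lemma inducedNorm_le {C : ℝ≥0∞}
    (hT : ∀ w, MemLp w 2 μ → eLpNorm w 2 μ ≠ 0 → eLpNorm (T w) 2 ν ≤ C * eLpNorm w 2 μ) :
    inducedNorm μ ν T ≤ C :=
  iSup_le fun w => iSup_le fun hw => iSup_le fun h0 => ENNReal.div_le_of_le_mul (hT w hw h0)

lemma le_inducedNorm_mul {w : α → E} (hw : MemLp w 2 μ) (h0 : eLpNorm w 2 μ ≠ 0) :
    eLpNorm (T w) 2 ν ≤ inducedNorm μ ν T * eLpNorm w 2 μ := by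
  rw [← ENNReal.div_le_iff h0 hw.2.ne]
  exact le_iSup_of_le w (le_iSup_of_le hw (le_iSup_of_le h0 le_rfl))

lemma exists_of_lt_inducedNorm {a : ℝ≥0∞} (ha : a < inducedNorm μ ν T) :
    ∃ w, MemLp w 2 μ ∧ eLpNorm w 2 μ ≠ 0 ∧ a * eLpNorm w 2 μ < eLpNorm (T w) 2 ν := by
  simp only [inducedNorm, lt_iSup_iff] at ha
  obtain ⟨w, hw, h0, hlt⟩ := ha
  exact ⟨w, hw, h0, (ENNReal.lt_div_iff_mul_lt (Or.inl h0) (Or.inl hw.2.ne)).1 hlt⟩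

end InducedNorm

section Lifted

variable {m : ℕ}

/-- Each value is held for time h/N. The same factor appears for outputs in `eLpNorm_resample`, so
it cancels in the induced norm. -/
lemma eLpNorm_hold_unlift {h : ℝ} (hh : 0 < h) {N : ℕ} (hN : 0 < N)
    (v : ℕ → EuclideanSpace ℝ (Fin N × Fin m)) :
    eLpNorm (hold (h / N) (unlift N v)) 2 timeMeasure =
      NNReal.sqrt (h / N).toNNReal * eLpNorm v 2 Measure.count := by
  have hδ : 0 < h / N := by positivity
  refine (ENNReal.pow_right_strictMono two_ne_zero).injective ?_
  rw [mul_pow, eLpNorm_two_sq, eLpNorm_two_sq,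
    lintegral_count, ← ENNReal.coe_pow, NNReal.sq_sqrt]
  nth_rw 2 [← lift_unlift hN v]
  rw [tsum_lift_sq hN]
  exact lintegral_hold_sq hδ _

lemma eLpNorm_resample {h : ℝ} (hh : 0 < h) {N : ℕ} (hN : 0 < N)
    (z : ℝ → EuclideanSpace ℝ (Fin m)) :
    eLpNorm (resample (h / N) z) 2 timeMeasure =
      NNReal.sqrt (h / N).toNNReal * eLpNorm (lift N (sampler (h / N) z)) 2 Measure.count := by
  rw [← eLpNorm_hold_unlift hh hN, unlift_lift hN]
  rfl

end Lifted

variable {n nw nu nz ny nk : ℕ} {G : Plant n nw nu nz ny} {h : ℝ} {M₁ M₂ : ℕ}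
  {Kd : Controller (Fin nk) (Fin M₁ × Fin ny) (Fin M₂ × Fin nu)}
  {K : (ℕ → EuclideanSpace ℝ (Fin ny)) → (ℕ → EuclideanSpace ℝ (Fin nu))}

namespace Plant.IsLoop

lemma eLpNorm_resample_multirate_le (H : G.IsLoop h M₁ M₂ Kd)
    (hKd : liftedController M₁ M₂ K = discSys Kd.A Kd.B Kd.C Kd.D) {N : ℕ} (hN : 0 < N)
    {s : ℕ → EuclideanSpace ℝ (Fin nw)} (hs : MemLp (hold (h / N) s) 2 timeMeasure)
    (h0 : eLpNorm (hold (h / N) s) 2 timeMeasure ≠ 0) :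
    eLpNorm (resample (h / N) (G.multirate h M₁ M₂ K (hold (h / N) s))) 2 timeMeasure ≤
      inducedNorm (Measure.count : Measure ℕ) (Measure.count : Measure ℕ) (G.fsfh h M₁ M₂ K N) *
        eLpNorm (hold (h / N) s) 2 timeMeasure := by
  have hh := H.period_pos
  have hc0 : ((NNReal.sqrt (h / N).toNNReal : ℝ≥0) : ℝ≥0∞) ≠ 0 := by
    have : 0 < h / N := by positivity
    simpa using this
  have hnorm := eLpNorm_hold_unlift hh hN (lift N s)
  rw [unlift_lift hN] at hnorm
  have hv0 : eLpNorm (lift N s) 2 (Measure.count : Measure ℕ) ≠ 0 := by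
    intro h1; rw [hnorm, h1, mul_zero] at h0; exact h0 rfl
  have hv : MemLp (lift N s) 2 (Measure.count : Measure ℕ) := by
    refine ⟨(measurable_of_countable _).aestronglyMeasurable, ?_⟩
    have h2 := hs.2
    rw [hnorm] at h2
    exact ENNReal.lt_top_of_mul_ne_top_right h2.ne hc0
  have h1 := le_inducedNorm_mul (T := G.fsfh h M₁ M₂ K N) (ν := (Measure.count : Measure ℕ)) hv hv0
  rw [fsfh_eq H.inputs_pos H.outputs_pos hKd H.bijective, unlift_lift hN] at h1
  rw [eLpNorm_resample hh hN, hnorm, mul_left_comm]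
  exact mul_le_mul_right h1 _

/-- Every sequence is the lift of its unlifting, so held inputs account for all inputs of the
approximation. -/
lemma inducedNorm_fsfh_le (H : G.IsLoop h M₁ M₂ Kd)
    (hKd : liftedController M₁ M₂ K = discSys Kd.A Kd.B Kd.C Kd.D) {N : ℕ} (hN : 0 < N) {C : ℝ≥0∞}
    (hC : ∀ s : ℕ → EuclideanSpace ℝ (Fin nw), MemLp (hold (h / N) s) 2 timeMeasure →
      eLpNorm (hold (h / N) s) 2 timeMeasure ≠ 0 →
      eLpNorm (resample (h / N) (G.multirate h M₁ M₂ K (hold (h / N) s))) 2 timeMeasure ≤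
        C * eLpNorm (hold (h / N) s) 2 timeMeasure) :
    inducedNorm (Measure.count : Measure ℕ) (Measure.count : Measure ℕ) (G.fsfh h M₁ M₂ K N) ≤
      C := by
  have hh := H.period_pos
  have hc0 : ((NNReal.sqrt (h / N).toNNReal : ℝ≥0) : ℝ≥0∞) ≠ 0 := by
    have : 0 < h / N := by positivity
    simpa using this
  refine inducedNorm_le fun v hv hv0 => ?_
  have hnorm := eLpNorm_hold_unlift hh hN v
  have h1 := hC (unlift N v) ⟨aestronglyMeasurable_hold _ _, by
      rw [hnorm]; exact ENNReal.mul_lt_top ENNReal.coe_lt_top hv.2⟩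
    (by rw [hnorm]; exact mul_ne_zero hc0 hv0)
  rw [eLpNorm_resample hh hN, hnorm, mul_left_comm,
    ENNReal.mul_le_mul_iff_right hc0 ENNReal.coe_ne_top] at h1
  rwa [fsfh_eq H.inputs_pos H.outputs_pos hKd H.bijective]

lemma inducedNorm_multirate_ne_top (H : G.IsLoop h M₁ M₂ Kd) (hst : G.Stable h M₁ M₂ Kd)
    (hKd : liftedController M₁ M₂ K = discSys Kd.A Kd.B Kd.C Kd.D) :
    inducedNorm timeMeasure timeMeasure (G.multirate h M₁ M₂ K) ≠ ∞ := by
  obtain ⟨C, hC⟩ := H.exists_eLpNorm_bound hst hKd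
  exact ((inducedNorm_le fun w hw _ => (hC w hw).2).trans_lt ENNReal.coe_lt_top).ne

lemma eventually_inducedNorm_fsfh_lt (H : G.IsLoop h M₁ M₂ Kd) (hst : G.Stable h M₁ M₂ Kd)
    (hKd : liftedController M₁ M₂ K = discSys Kd.A Kd.B Kd.C Kd.D) {a : ℝ≥0∞}
    (ha : inducedNorm timeMeasure timeMeasure (G.multirate h M₁ M₂ K) < a) :
    ∀ᶠ N : ℕ in atTop, inducedNorm (Measure.count : Measure ℕ) (Measure.count : Measure ℕ)
      (G.fsfh h M₁ M₂ K N) < a := by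
  obtain ⟨C, hC⟩ := H.exists_eLpNorm_bound hst hKd
  obtain ⟨ε, hε, hlt⟩ := ENNReal.lt_iff_exists_add_pos_lt.1 ha
  filter_upwards [eventually_gt_atTop 0, H.eventually_resample_close hst hKd hε] with N hN hclose
  refine (H.inducedNorm_fsfh_le hKd hN fun s hs h0 => ?_).trans_lt hlt
  set w := hold (h / N) s
  set T := G.multirate h M₁ M₂ K w
  have hsplit : resample (h / N) T = T - (T - resample (h / N) T) := by abel
  rw [hsplit]
  refine (eLpNorm_sub_le (hC w hs).1 ((hC w hs).1.sub (aestronglyMeasurable_hold _ _))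
    one_le_two).trans ?_
  rw [add_mul]
  exact add_le_add (le_inducedNorm_mul hs h0) (hclose s)

lemma eventually_lt_inducedNorm_fsfh (H : G.IsLoop h M₁ M₂ Kd) (hst : G.Stable h M₁ M₂ Kd)
    (hKd : liftedController M₁ M₂ K = discSys Kd.A Kd.B Kd.C Kd.D) {a : ℝ≥0∞}
    (ha : a < inducedNorm timeMeasure timeMeasure (G.multirate h M₁ M₂ K)) :
    ∀ᶠ N : ℕ in atTop, a < inducedNorm (Measure.count : Measure ℕ) (Measure.count : Measure ℕ)
      (G.fsfh h M₁ M₂ K N) := by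
  obtain ⟨C, hC⟩ := H.exists_eLpNorm_bound hst hKd
  obtain ⟨w, hw, -, hlt⟩ := exists_of_lt_inducedNorm ha
  lift a to ℝ≥0 using ha.ne_top
  obtain ⟨b, hb⟩ : ∃ b : ℝ≥0, eLpNorm w 2 timeMeasure = b :=
    ⟨_, (ENNReal.coe_toNNReal hw.2.ne).symm⟩
  -- Splitting 𝒯w = 𝒯(w − w') + 𝒯w' with w' held will bound the output by Cε + (a + ε)(b + ε), which
  -- tends to ab < ‖𝒯w‖ as ε → 0.
  obtain ⟨ε, hε, hεlt⟩ : ∃ ε : ℝ≥0, 0 < ε ∧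
      ((C * ε + (a + ε) * (b + ε) : ℝ≥0) : ℝ≥0∞) <
        eLpNorm (G.multirate h M₁ M₂ K w) 2 timeMeasure := by
    have hcont : Continuous fun ε : ℝ≥0 => ((C * ε + (a + ε) * (b + ε) : ℝ≥0) : ℝ≥0∞) :=
      ENNReal.continuous_coe.comp (by fun_prop)
    have h1 := hcont.tendsto 0
    rw [hb, ← ENNReal.coe_mul] at hlt
    simp only [mul_zero, add_zero, zero_add] at h1
    have h2 := (h1.mono_left (nhdsWithin_le_nhds (s := Set.Ioi 0))).eventually (gt_mem_nhds hlt)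
    obtain ⟨ε, h3, h4⟩ := (h2.and self_mem_nhdsWithin).exists
    exact ⟨ε, h4, h3⟩
  filter_upwards [eventually_gt_atTop 0, H.eventually_resample_close hst hKd hε,
    eventually_exists_hold_close H.period_pos hw (ENNReal.coe_ne_zero.2 hε.ne')]
    with N hN hclose hdense
  obtain ⟨s, hs⟩ := hdense
  by_contra! hle
  refine absurd hεlt (not_lt.2 ?_)
  set w' := hold (h / N) s with hw'def
  have hdiff : MemLp (w - w') 2 timeMeasure :=
    ⟨hw.1.sub (aestronglyMeasurable_hold _ _), hs.trans_lt ENNReal.coe_lt_top⟩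
  have hw' : MemLp w' 2 timeMeasure := by
    have := hw.sub hdiff
    rwa [sub_sub_cancel] at this
  have hw'b : eLpNorm w' 2 timeMeasure ≤ b + ε := by
    have h1 : w' = w - (w - w') := by abel
    rw [h1]
    exact (eLpNorm_sub_le hw.1 hdiff.1 one_le_two).trans (add_le_add hb.le hs)
  have hTw' : eLpNorm (G.multirate h M₁ M₂ K w') 2 timeMeasure ≤
      (a + ε) * eLpNorm w' 2 timeMeasure := by
    -- The induced norm says nothing about inputs of norm zero; boundedness of 𝒯 covers them.
    by_cases h0 : eLpNorm w' 2 timeMeasure = 0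
    · refine (hC w' hw').2.trans ?_
      simp [h0]
    · set T := G.multirate h M₁ M₂ K w'
      have hsplit : T = resample (h / N) T + (T - resample (h / N) T) := by abel
      rw [hsplit, add_mul]
      refine (eLpNorm_add_le (aestronglyMeasurable_hold _ _)
        ((hC w' hw').1.sub (aestronglyMeasurable_hold _ _)) one_le_two).trans ?_
      exact add_le_add ((H.eLpNorm_resample_multirate_le hKd hN hw' h0).trans
        (mul_le_mul_left hle _)) (hclose s)
  have hsum : G.multirate h M₁ M₂ K w =ᵐ[timeMeasure]
      G.multirate h M₁ M₂ K (w - w') + G.multirate h M₁ M₂ K w' := by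
    refine (ae_restrict_iff' measurableSet_Ici).2 (ae_of_all _ fun t ht => ?_)
    have := H.multirate_add hKd (locInt_of_memLp hdiff) (locInt_of_memLp hw') ht
    rwa [sub_add_cancel] at this
  rw [eLpNorm_congr_ae hsum]
  refine (eLpNorm_add_le (hC _ hdiff).1 (hC _ hw').1 one_le_two).trans ?_
  push_cast
  exact add_le_add ((hC _ hdiff).2.trans (mul_le_mul_right hs _))
    (hTw'.trans (mul_le_mul_right hw'b _))

end Plant.IsLoop

end

end

end SampledData

open SampledData in
theorem mainTheorem4 {n nw nu nz ny nk : ℕ} (G : Plant n nw nu nz ny)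
    (h : ℝ) (hh : 0 < h) (M₁ M₂ : ℕ) (hM₁ : 0 < M₁) (hM₂ : 0 < M₂)
    -- the controller, periodic, with a finite-dimensional realization `Kd` of its lifting
    (K : (ℕ → EuclideanSpace ℝ (Fin ny)) →ₗ[ℝ] (ℕ → EuclideanSpace ℝ (Fin nu)))
    (hK : IsPeriodic M₁ M₂ K)
    (Kd : Controller (Fin nk) (Fin M₁ × Fin ny) (Fin M₂ × Fin nu))
    (hKd : liftedController M₁ M₂ K = discSys Kd.A Kd.B Kd.C Kd.D)
    -- the closed loop is well-posed and internally stable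
    (hwp : G.WellPosed h M₁ M₂ Kd) (hst : G.Stable h M₁ M₂ Kd) :
    -- the inverses in both linear fractional transformations exist
    Function.Bijective (loopMap G.G₂₂ (Plant.heldController h M₁ M₂ K)) ∧
    Function.Bijective (loopMap (discLift h M₁ M₂ G.G₂₂) (liftedController M₁ M₂ K)) ∧
    -- `𝒯` is a bounded operator on `L²[0, ∞)`
    (∀ w, MemLp w 2 timeMeasure → MemLp (G.multirate h M₁ M₂ K w) 2 timeMeasure) ∧
    inducedNorm timeMeasure timeMeasure (G.multirate h M₁ M₂ K) ≠ ∞ ∧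
    -- each approximation is a finite-dimensional LTI system
    (∀ N : ℕ, 0 < N → ∃ (B : Matrix (Fin n ⊕ Fin nk) (Fin N × Fin nw) ℝ)
      (C : Matrix (Fin N × Fin nz) (Fin n ⊕ Fin nk) ℝ)
      (D : Matrix (Fin N × Fin nz) (Fin N × Fin nw) ℝ),
      G.fsfh h M₁ M₂ K N = discSys (G.closedLoop h M₁ M₂ Kd) B C D) ∧
    -- convergence of the norms
    Tendsto (fun N : ℕ => inducedNorm (Measure.count : Measure ℕ) (Measure.count : Measure ℕ)
        (G.fsfh h M₁ M₂ K N)) atTop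
      (𝓝 (inducedNorm timeMeasure timeMeasure (G.multirate h M₁ M₂ K))) := by
  have H : G.IsLoop h M₁ M₂ Kd := ⟨hh, hM₁, hM₂, hwp⟩
  have hbij : Function.Bijective
      (loopMap (discLift h M₁ M₂ G.G₂₂) (liftedController M₁ M₂ K)) := by
    rw [hKd]
    exact H.bijective
  obtain ⟨C, hC⟩ := H.exists_eLpNorm_bound hst hKd
  refine ⟨bijective_loopMap_of_lifted hM₁ hM₂ K hbij, hbij, fun w hw => ⟨(hC w hw).1, ?_⟩,
    H.inducedNorm_multirate_ne_top hst hKd, fun N hN => H.exists_realization hKd hN, ?_⟩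
  · exact (hC w hw).2.trans_lt (ENNReal.mul_lt_top ENNReal.coe_lt_top hw.2)
  · exact tendsto_order.2 ⟨fun a ha => H.eventually_lt_inducedNorm_fsfh hst hKd ha,
      fun a ha => H.eventually_inducedNorm_fsfh_lt hst hKd ha⟩
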